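/- Let $X$ be a metric space and let $\mathscr{H}$ be an ample $X$-module, i.e. a complex Hilbert space with a nondegenerate $*$-representation of $C_0(X)$ in which only $f=0$ acts as a compact operator; for Borel $W\subseteq X$ let $\chi_W$ be the projection given by the extension of the representation to bounded Borel functions. The Roe algebra $C^*_{\mathrm{Roe}}(X)$ is the norm closure in $B(\mathscr{H})$ of the set of operators $T$ that are locally compact ($\chi_WT$ and $T\chi_W$ are compact for all bounded Borel $W$) and have finite propagation (for some $r\ge 0$, $\chi_VT\chi_W=0$ whenever $d(V,W)>r$). For $Y\subseteq X$ let $\{Y\}$ be the family of all $Z\subseteq X$ contained in $B_r(Y)=\{x:\ d(x,y)\le r\text{ for some }y\in Y\}$ for some $r>0$, and let $\partial Y=\{Z\cap Z' : Z\in\{Y\},\,Z'\in\{X\setminus Y\}\}$. For such a family $\mathcal{Y}$, $C^*_{\mathrm{Roe}}(\mathcal{Y})$ is the closed ideal of $C^*_{\mathrm{Roe}}(X)$ obtained as the closure of the set of all $T\in C^*_{\mathrm{Roe}}(X)$ for which there is $Z\in\mathcal{Y}$ with $fT=Tf=0$ for all $f\in C_0(X)$ with support in $X\setminus Z$. One has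 $C^*_{\mathrm{Roe}}(X)=C^*_{\mathrm{Roe}}(\{Y\})+C^*_{\mathrm{Roe}}(\{X\setminus Y\})$ and $C^*_{\mathrm{Roe}}(\{Y\})\cap C^*_{\mathrm{Roe}}(\{X\setminus Y\})=C^*_{\mathrm{Roe}}(\partial Y)$, and the Mayer–Vietoris boundary map $$\partial: K_0(C^*_{\mathrm{Roe}}(X))\to K_0\bigl(C^*_{\mathrm{Roe}}(X)/C^*_{\mathrm{Roe}}(\{X\setminus Y\})\bigr)\cong K_0\bigl(C^*_{\mathrm{Roe}}(\{Y\})/C^*_{\mathrm{Roe}}(\partial Y)\bigr)\xrightarrow{\mathrm{Exp}} K_1(C^*_{\mathrm{Roe}}(\partial Y))$$ is the composition with the exponential map $\mathrm{Exp}[q]=[\exp(2\pi i\tilde q)]$, $\tilde q$ a self-adjoint lift of the projection $q$. Let $H$ be a (possibly unbounded) positive self-adjoint operator on $\mathscr{H}$ with $f(H)\in C^*_{\mathrm{Roe}}(X)$ for all $f\in C_c(\mathbb{R})$. Let $Y\subseteq X$ and let $\tilde H$ be a Hamiltonian on $Y$ adapted to $H$: a (possibly unbounded) self-adjoint operator,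 bounded from below, on $\mathscr{H}$ or, more generally, on a Hilbert space isometrically embedded in $\mathscr{H}$, such that for all $f\in C_0(\mathbb{R})$ $$f(\tilde H)\in C^*_{\mathrm{Roe}}(\{Y\})\quad\text{and}\quad f(H)-f(\tilde H)\in C^*_{\mathrm{Roe}}(\{X\setminus Y\}),$$ where $f(\tilde H)$ is extended by zero to $\mathscr{H}$. Suppose that $H$ is insulating at $E\in\mathbb{R}$, i.e. $E\notin\mathrm{spec}(H)$, and let $[p_E]\in K_0(C^*_{\mathrm{Roe}}(X))$ be the class of the Fermi projection $p_E$, the spectral projection of $H$ for $(-\infty,E)$ (which lies in $C^*_{\mathrm{Roe}}(X)$). If $$\partial([p_E])\neq 0\quad\text{in } K_1(C^*_{\mathrm{Roe}}(\partial Y)),$$ then $E\in\mathrm{spec}(\tilde H)$. -/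

import Mathlib

noncomputable section

namespace KTheory

/-- A projection in some matrix algebra `M_ι(B)`, with `ι` a finite index set. -/
structure ProjMatrix (B : Type*) [CStarAlgebra B] where
  ι : Type
  [fin : Fintype ι]
  [dec : DecidableEq ι]
  mat : Matrix ι ι B
  isProj : IsStarProjection mat

/-- A unitary in some matrix algebra `M_ι(B)`, with `ι` a finite index set. -/
structure UnitaryMatrix (B : Type*) [CStarAlgebra B] where
  ι : Type
  [fin : Fintype ι]
  [dec : DecidableEq ι]
  mat : Matrix ι ι B
  isUnitary : mat ∈ unitary (Matrix ι ι B)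

attribute [instance] ProjMatrix.fin ProjMatrix.dec UnitaryMatrix.fin UnitaryMatrix.dec

section

variable {B : Type*} [CStarAlgebra B]
variable {ι κ : Type} [Fintype ι] [Fintype κ]

theorem isStarProjection_reindex {p : Matrix ι ι B} (hp : IsStarProjection p) (e : ι ≃ κ) :
    IsStarProjection (Matrix.reindex e e p) := by
  refine ⟨?_, ?_⟩
  · have := hp.isIdempotentElem.eq
    simp only [IsIdempotentElem, Matrix.reindex_apply, Matrix.submatrix_mul_equiv, this]
  · have := hp.isSelfAdjoint.star_eq
    rw [Matrix.star_eq_conjTranspose] at this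
    simp [IsSelfAdjoint, Matrix.star_eq_conjTranspose, this]

theorem isStarProjection_blocks {p : Matrix ι ι B} {q : Matrix κ κ B}
    (hp : IsStarProjection p) (hq : IsStarProjection q) :
    IsStarProjection (Matrix.fromBlocks p 0 0 q) := by
  refine ⟨?_, ?_⟩
  · have h1 := hp.isIdempotentElem.eq
    have h2 := hq.isIdempotentElem.eq
    simp [IsIdempotentElem, Matrix.fromBlocks_multiply, h1, h2]
  · have h1 := hp.isSelfAdjoint.star_eq
    have h2 := hq.isSelfAdjoint.star_eq
    rw [Matrix.star_eq_conjTranspose] at h1 h2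
    simp [IsSelfAdjoint, Matrix.star_eq_conjTranspose, Matrix.fromBlocks_conjTranspose, h1, h2]

theorem unitary_reindex [DecidableEq ι] [DecidableEq κ] {u : Matrix ι ι B}
    (hu : u ∈ unitary (Matrix ι ι B)) (e : ι ≃ κ) :
    Matrix.reindex e e u ∈ unitary (Matrix κ κ B) := by
  rw [Unitary.mem_iff, Matrix.star_eq_conjTranspose] at hu ⊢
  simp [hu.1, hu.2]

theorem unitary_blocks [DecidableEq ι] [DecidableEq κ] {u : Matrix ι ι B} {v : Matrix κ κ B}
    (hu : u ∈ unitary (Matrix ι ι B)) (hv : v ∈ unitary (Matrix κ κ B)) :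
    Matrix.fromBlocks u 0 0 v ∈ unitary (Matrix (ι ⊕ κ) (ι ⊕ κ) B) := by
  rw [Unitary.mem_iff, Matrix.star_eq_conjTranspose] at hu hv ⊢
  simp [Matrix.fromBlocks_conjTranspose, Matrix.fromBlocks_multiply, hu.1, hu.2, hv.1, hv.2,
    Matrix.fromBlocks_one]

end

variable (B : Type*) [CStarAlgebra B]

/-- The elementary moves between projections over `B`: renaming the index set, adding a zero block,
and norm-continuous homotopy through projections. -/
inductive ProjMatrix.Rel : ProjMatrix B → ProjMatrix B → Prop
  | reindex {ι κ : Type} [Fintype ι] [Fintype κ] [DecidableEq ι] [DecidableEq κ] (e : ι ≃ κ)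
      (p : Matrix ι ι B) (hp : IsStarProjection p) :
      Rel ⟨ι, p, hp⟩ ⟨κ, Matrix.reindex e e p, isStarProjection_reindex hp e⟩
  | stabilize {ι κ : Type} [Fintype ι] [Fintype κ] [DecidableEq ι] [DecidableEq κ]
      (p : Matrix ι ι B) (hp : IsStarProjection p) :
      Rel ⟨ι, p, hp⟩ ⟨ι ⊕ κ, Matrix.fromBlocks p 0 0 0, isStarProjection_blocks hp (.zero _)⟩
  | homotopy {ι : Type} [Fintype ι] [DecidableEq ι] (p q : Matrix ι ι B) (hp : IsStarProjection p)
      (hq : IsStarProjection q) (h : JoinedIn {x : Matrix ι ι B | IsStarProjection x} p q) :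
      Rel ⟨ι, p, hp⟩ ⟨ι, q, hq⟩

/-- The elementary moves between unitaries over `B`: renaming the index set, adding an identity
block, and norm-continuous homotopy through unitaries. -/
inductive UnitaryMatrix.Rel : UnitaryMatrix B → UnitaryMatrix B → Prop
  | reindex {ι κ : Type} [Fintype ι] [Fintype κ] [DecidableEq ι] [DecidableEq κ] (e : ι ≃ κ)
      (u : Matrix ι ι B) (hu : u ∈ unitary (Matrix ι ι B)) :
      Rel ⟨ι, u, hu⟩ ⟨κ, Matrix.reindex e e u, unitary_reindex hu e⟩
  | stabilize {ι κ : Type} [Fintype ι] [Fintype κ] [DecidableEq ι] [DecidableEq κ]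
      (u : Matrix ι ι B) (hu : u ∈ unitary (Matrix ι ι B)) :
      Rel ⟨ι, u, hu⟩ ⟨ι ⊕ κ, Matrix.fromBlocks u 0 0 1, unitary_blocks hu (one_mem _)⟩
  | homotopy {ι : Type} [Fintype ι] [DecidableEq ι] (u v : Matrix ι ι B)
      (hu : u ∈ unitary (Matrix ι ι B)) (hv : v ∈ unitary (Matrix ι ι B))
      (h : JoinedIn (unitary (Matrix ι ι B) : Set (Matrix ι ι B)) u v) :
      Rel ⟨ι, u, hu⟩ ⟨ι, v, hv⟩

/-- The monoid `V(B)` of stable homotopy classes of projections in matrix algebras over `B`,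
with the block sum as addition. -/
def V : Type _ := Quot (ProjMatrix.Rel B)

/-- The `K₁`-group of a unital C⋆-algebra: stable homotopy classes of unitaries in matrix algebras
over `B`, with the block sum as addition. -/
def UnitalK1 : Type _ := Quot (UnitaryMatrix.Rel B)

variable {B}

/-- The class of a projection matrix in `V(B)`. -/
def V.mk {ι : Type} [Fintype ι] [DecidableEq ι] (p : Matrix ι ι B) (hp : IsStarProjection p) : V B :=
  Quot.mk _ ⟨ι, p, hp⟩

/-- The class of a unitary matrix in `K₁(B)`. -/
def UnitalK1.mk {ι : Type} [Fintype ι] [DecidableEq ι] (u : Matrix ι ι B)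
    (hu : u ∈ unitary (Matrix ι ι B)) : UnitalK1 B :=
  Quot.mk _ ⟨ι, u, hu⟩

section V

variable {ι κ : Type} [Fintype ι] [Fintype κ] [DecidableEq ι] [DecidableEq κ]

theorem V.mk_reindex (e : ι ≃ κ) (p : Matrix ι ι B) (hp : IsStarProjection p) :
    V.mk (Matrix.reindex e e p) (isStarProjection_reindex hp e) = V.mk p hp :=
  (Quot.sound (.reindex e p hp)).symm

theorem V.mk_eq_of_reindex (e : ι ≃ κ) {p : Matrix ι ι B} {hp : IsStarProjection p}
    {q : Matrix κ κ B} {hq : IsStarProjection q} (h : q = Matrix.reindex e e p) :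
    V.mk p hp = V.mk q hq := by
  subst h; exact (V.mk_reindex e p hp).symm

theorem V.mk_stabilize (p : Matrix ι ι B) (hp : IsStarProjection p) :
    V.mk (Matrix.fromBlocks p 0 0 (0 : Matrix κ κ B)) (isStarProjection_blocks hp (.zero _)) =
      V.mk p hp :=
  (Quot.sound (.stabilize p hp)).symm

theorem V.mk_homotopy {p q : Matrix ι ι B} (hp : IsStarProjection p) (hq : IsStarProjection q)
    (h : JoinedIn {x : Matrix ι ι B | IsStarProjection x} p q) : V.mk p hp = V.mk q hq :=
  Quot.sound (.homotopy p q hp hq h)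

theorem joinedIn_map {X Y : Type*} [TopologicalSpace X] [TopologicalSpace Y] {S : Set X}
    {T : Set Y} {x y : X} (h : JoinedIn S x y) {f : X → Y} (hf : Continuous f)
    (hST : ∀ z ∈ S, f z ∈ T) : JoinedIn T (f x) (f y) := by
  obtain ⟨γ, hγ⟩ := h
  exact ⟨γ.map hf, fun t => hST _ (hγ t)⟩

/-- Block sum of projections. -/
def ProjMatrix.add (P Q : ProjMatrix B) : ProjMatrix B :=
  ⟨P.ι ⊕ Q.ι, Matrix.fromBlocks P.mat 0 0 Q.mat, isStarProjection_blocks P.isProj Q.isProj⟩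

theorem ProjMatrix.mk_add_comm (P Q : ProjMatrix B) :
    (Quot.mk _ (P.add Q) : V B) = Quot.mk _ (Q.add P) :=
  V.mk_eq_of_reindex (Equiv.sumComm _ _) (by
    ext i j; rcases i with i | i <;> rcases j with j | j <;> simp [Matrix.fromBlocks])

theorem ProjMatrix.mk_add_congr_left (P Q R : ProjMatrix B) (h : ProjMatrix.Rel B P Q) :
    (Quot.mk _ (P.add R) : V B) = Quot.mk _ (Q.add R) := by
  cases h with
  | reindex e p hp =>
    exact V.mk_eq_of_reindex (Equiv.sumCongr e (Equiv.refl _)) (by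
      ext i j; rcases i with i | i <;> rcases j with j | j <;>
        simp [Matrix.fromBlocks])
  | @stabilize ι κ _ _ _ _ p hp =>
    refine (V.mk_stabilize (κ := κ) (Matrix.fromBlocks p 0 0 R.mat)
      (isStarProjection_blocks hp R.isProj)).symm.trans ?_
    refine V.mk_eq_of_reindex ((Equiv.sumAssoc _ _ _).trans <| (Equiv.sumCongr (Equiv.refl _)
      (Equiv.sumComm _ _)).trans (Equiv.sumAssoc _ _ _).symm) ?_
    ext i j
    rcases i with (i | i) | i <;> rcases j with (j | j) | j <;> simp [Matrix.fromBlocks]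
  | homotopy p q hp hq h =>
    refine V.mk_homotopy _ _ (joinedIn_map h (f := fun x => Matrix.fromBlocks x 0 0 R.mat) ?_ ?_)
    · exact Continuous.matrix_fromBlocks continuous_id continuous_const continuous_const
        continuous_const
    · exact fun z hz => isStarProjection_blocks hz R.isProj

instance : Add (V B) :=
  ⟨Quot.lift₂ (fun P Q => Quot.mk _ (P.add Q))
    (fun P Q R h => by
      rw [ProjMatrix.mk_add_comm P Q, ProjMatrix.mk_add_comm P R]
      exact ProjMatrix.mk_add_congr_left _ _ _ h)
    (fun P Q R h => ProjMatrix.mk_add_congr_left _ _ _ h)⟩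

instance : Zero (V B) := ⟨V.mk (0 : Matrix Empty Empty B) (.zero _)⟩

theorem V.mk_add_mk (p : Matrix ι ι B) (hp : IsStarProjection p) (q : Matrix κ κ B)
    (hq : IsStarProjection q) :
    V.mk p hp + V.mk q hq = V.mk (Matrix.fromBlocks p 0 0 q) (isStarProjection_blocks hp hq) :=
  rfl

theorem V.mk_zero : V.mk (0 : Matrix ι ι B) (.zero _) = 0 := by
  refine Eq.trans ?_ (V.mk_stabilize (κ := ι) (0 : Matrix Empty Empty B) (.zero _))
  refine V.mk_eq_of_reindex (Equiv.emptySum _ _).symm ?_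
  ext i j; rcases i with i | i <;> rcases j with j | j <;> simp [Matrix.fromBlocks]

instance : AddCommMonoid (V B) where
  add_assoc a b c := by
    induction a using Quot.ind; induction b using Quot.ind; induction c using Quot.ind
    refine V.mk_eq_of_reindex (Equiv.sumAssoc _ _ _) ?_
    ext i j
    rcases i with i | i | i <;> rcases j with j | j | j <;> rfl
  zero_add a := by
    induction a using Quot.ind
    refine V.mk_eq_of_reindex (Equiv.emptySum _ _) ?_
    ext i j; simp [Matrix.fromBlocks]
  add_zero a := by
    induction a using Quot.ind
    refine V.mk_eq_of_reindex (Equiv.sumEmpty _ _) ?_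
    ext i j; simp [Matrix.fromBlocks]
  add_comm a b := by
    induction a using Quot.ind; induction b using Quot.ind
    exact ProjMatrix.mk_add_comm _ _
  nsmul := nsmulRec

end V

section K1

variable {ι κ : Type} [Fintype ι] [Fintype κ] [DecidableEq ι] [DecidableEq κ]

theorem UnitalK1.mk_eq_of_reindex (e : ι ≃ κ) {u : Matrix ι ι B}
    {hu : u ∈ unitary (Matrix ι ι B)} {v : Matrix κ κ B} {hv : v ∈ unitary (Matrix κ κ B)}
    (h : v = Matrix.reindex e e u) : UnitalK1.mk u hu = UnitalK1.mk v hv := by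
  subst h; exact Quot.sound (.reindex e u hu)

theorem UnitalK1.mk_stabilize (u : Matrix ι ι B) (hu : u ∈ unitary (Matrix ι ι B)) :
    UnitalK1.mk (Matrix.fromBlocks u 0 0 (1 : Matrix κ κ B)) (unitary_blocks hu (one_mem _)) =
      UnitalK1.mk u hu :=
  (Quot.sound (.stabilize u hu)).symm

theorem UnitalK1.mk_homotopy {u v : Matrix ι ι B} (hu : u ∈ unitary (Matrix ι ι B))
    (hv : v ∈ unitary (Matrix ι ι B))
    (h : JoinedIn (unitary (Matrix ι ι B) : Set (Matrix ι ι B)) u v) :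
    UnitalK1.mk u hu = UnitalK1.mk v hv :=
  Quot.sound (.homotopy u v hu hv h)

/-- Block sum of unitaries. -/
def UnitaryMatrix.add (P Q : UnitaryMatrix B) : UnitaryMatrix B :=
  ⟨P.ι ⊕ Q.ι, Matrix.fromBlocks P.mat 0 0 Q.mat, unitary_blocks P.isUnitary Q.isUnitary⟩

/-- The adjoint of a unitary. -/
def UnitaryMatrix.neg (P : UnitaryMatrix B) : UnitaryMatrix B :=
  ⟨P.ι, star P.mat, Unitary.star_mem P.isUnitary⟩

theorem UnitaryMatrix.mk_add_comm (P Q : UnitaryMatrix B) :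
    (Quot.mk _ (P.add Q) : UnitalK1 B) = Quot.mk _ (Q.add P) :=
  UnitalK1.mk_eq_of_reindex (Equiv.sumComm _ _) (by
    ext i j; rcases i with i | i <;> rcases j with j | j <;> simp [Matrix.fromBlocks])

theorem UnitaryMatrix.mk_add_congr_left (P Q R : UnitaryMatrix B) (h : UnitaryMatrix.Rel B P Q) :
    (Quot.mk _ (P.add R) : UnitalK1 B) = Quot.mk _ (Q.add R) := by
  cases h with
  | reindex e u hu =>
    exact UnitalK1.mk_eq_of_reindex (Equiv.sumCongr e (Equiv.refl _)) (by
      ext i j; rcases i with i | i <;> rcases j with j | j <;>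
        simp [Matrix.fromBlocks])
  | @stabilize ι κ _ _ _ _ u hu =>
    refine (UnitalK1.mk_stabilize (κ := κ) (Matrix.fromBlocks u 0 0 R.mat)
      (unitary_blocks hu R.isUnitary)).symm.trans ?_
    refine UnitalK1.mk_eq_of_reindex ((Equiv.sumAssoc _ _ _).trans <| (Equiv.sumCongr (Equiv.refl _)
      (Equiv.sumComm _ _)).trans (Equiv.sumAssoc _ _ _).symm) ?_
    ext i j
    rcases i with (i | i) | i <;> rcases j with (j | j) | j <;> simp [Matrix.fromBlocks]
  | homotopy u v hu hv h =>
    refine UnitalK1.mk_homotopy _ _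
      (joinedIn_map h (f := fun x => Matrix.fromBlocks x 0 0 R.mat) ?_ ?_)
    · exact Continuous.matrix_fromBlocks continuous_id continuous_const continuous_const
        continuous_const
    · exact fun z hz => unitary_blocks hz R.isUnitary

theorem UnitaryMatrix.mk_neg_congr (P Q : UnitaryMatrix B) (h : UnitaryMatrix.Rel B P Q) :
    (Quot.mk _ P.neg : UnitalK1 B) = Quot.mk _ Q.neg := by
  cases h with
  | reindex e u hu =>
    exact UnitalK1.mk_eq_of_reindex e (by ext i j; simp [Matrix.star_apply])
  | @stabilize ι κ _ _ _ _ u hu =>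
    refine (UnitalK1.mk_stabilize (κ := κ) (star u) (Unitary.star_mem hu)).symm.trans ?_
    refine UnitalK1.mk_eq_of_reindex (Equiv.refl _) ?_
    simp [Matrix.star_eq_conjTranspose, Matrix.fromBlocks_conjTranspose]
  | homotopy u v hu hv h =>
    exact UnitalK1.mk_homotopy _ _ (joinedIn_map h continuous_star fun z hz => Unitary.star_mem hz)

instance : Add (UnitalK1 B) :=
  ⟨Quot.lift₂ (fun P Q => Quot.mk _ (P.add Q))
    (fun P Q R h => by
      rw [UnitaryMatrix.mk_add_comm P Q, UnitaryMatrix.mk_add_comm P R]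
      exact UnitaryMatrix.mk_add_congr_left _ _ _ h)
    (fun P Q R h => UnitaryMatrix.mk_add_congr_left _ _ _ h)⟩

instance : Neg (UnitalK1 B) :=
  ⟨Quot.lift (fun P => Quot.mk _ P.neg) UnitaryMatrix.mk_neg_congr⟩

instance : Zero (UnitalK1 B) := ⟨UnitalK1.mk (1 : Matrix Empty Empty B) (one_mem _)⟩

theorem UnitalK1.mk_add_mk (u : Matrix ι ι B) (hu : u ∈ unitary (Matrix ι ι B))
    (v : Matrix κ κ B) (hv : v ∈ unitary (Matrix κ κ B)) :
    UnitalK1.mk u hu + UnitalK1.mk v hv =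
      UnitalK1.mk (Matrix.fromBlocks u 0 0 v) (unitary_blocks hu hv) :=
  rfl

theorem UnitalK1.mk_one : UnitalK1.mk (1 : Matrix ι ι B) (one_mem _) = 0 := by
  refine Eq.trans ?_ (UnitalK1.mk_stabilize (κ := ι) (1 : Matrix Empty Empty B) (one_mem _))
  refine UnitalK1.mk_eq_of_reindex (Equiv.emptySum _ _).symm ?_
  ext i j
  rcases i with i | i <;> rcases j with j | j <;> first | exact i.elim | exact j.elim | skip
  rfl

/-- The unitary rotation matrix by the angle `t` in two blocks of equal size. -/
def rotation (ι : Type) [Fintype ι] [DecidableEq ι] (B : Type*) [CStarAlgebra B] (t : ℝ) :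
    Matrix (ι ⊕ ι) (ι ⊕ ι) B :=
  Matrix.fromBlocks ((Real.cos t : ℂ) • 1) (-((Real.sin t : ℂ) • 1)) ((Real.sin t : ℂ) • 1)
    ((Real.cos t : ℂ) • 1)

theorem rotation_mem (t : ℝ) :
    rotation ι B t ∈ unitary (Matrix (ι ⊕ ι) (ι ⊕ ι) B) := by
  have h : (Real.cos t : ℂ) * Real.cos t + (Real.sin t : ℂ) * Real.sin t = 1 := by
    have := Real.cos_sq_add_sin_sq t
    rw [pow_two, pow_two] at this
    exact_mod_cast this
  have h' : (Real.sin t : ℂ) * Real.sin t + (Real.cos t : ℂ) * Real.cos t = 1 := by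
    rw [add_comm, h]
  have e1 : (starRingEnd ℂ) (Real.cos t : ℂ) = Real.cos t := Complex.conj_ofReal _
  have e2 : (starRingEnd ℂ) (Real.sin t : ℂ) = Real.sin t := Complex.conj_ofReal _
  rw [Unitary.mem_iff, Matrix.star_eq_conjTranspose, rotation, Matrix.fromBlocks_conjTranspose,
    Matrix.fromBlocks_multiply, Matrix.fromBlocks_multiply, ← Matrix.fromBlocks_one]
  simp only [Matrix.conjTranspose_smul, Matrix.conjTranspose_neg, Matrix.conjTranspose_one,
    Complex.star_def, e1, e2, smul_mul_smul_comm, mul_one, neg_mul, mul_neg, neg_neg, ← add_smul,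
    ← sub_eq_add_neg, h, h', one_smul]
  constructor <;> congr 1 <;> rw [mul_comm] <;> simp

theorem continuous_rotation : Continuous (rotation ι B) := by
  unfold rotation
  refine Continuous.matrix_fromBlocks ?_ ?_ ?_ ?_ <;> fun_prop

theorem UnitalK1.mk_neg_add (u : Matrix ι ι B) (hu : u ∈ unitary (Matrix ι ι B)) :
    UnitalK1.mk (Matrix.fromBlocks (star u) 0 0 u) (unitary_blocks (Unitary.star_mem hu) hu) =
      0 := by
  rw [← UnitalK1.mk_one (ι := ι ⊕ ι)]
  refine UnitalK1.mk_homotopy _ _ ?_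
  have hu' := hu
  rw [Unitary.mem_iff] at hu'
  refine JoinedIn.ofLine (f := fun t : ℝ => Matrix.fromBlocks (star u) 0 0 1 *
    rotation ι B (t * (Real.pi / 2)) * Matrix.fromBlocks 1 0 0 u *
      star (rotation ι B (t * (Real.pi / 2)))) ?_ ?_ ?_ ?_
  · have := (continuous_rotation (ι := ι) (B := B)).comp
      (continuous_id.mul (continuous_const (y := Real.pi / 2)))
    exact (((continuous_const.mul this).mul continuous_const).mul
      (continuous_star.comp this)).continuousOn
  · simp [rotation, Matrix.fromBlocks_multiply, Matrix.star_eq_conjTranspose]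
  · simp [rotation, Matrix.fromBlocks_multiply, Matrix.star_eq_conjTranspose,
      Matrix.fromBlocks_conjTranspose]
    rw [Matrix.star_eq_conjTranspose] at hu'
    rw [hu'.1, Matrix.fromBlocks_one]
  · rintro _ ⟨t, -, rfl⟩
    exact mul_mem (mul_mem (mul_mem (unitary_blocks (Unitary.star_mem hu) (one_mem _))
      (rotation_mem _)) (unitary_blocks (one_mem _) hu)) (Unitary.star_mem (rotation_mem _))

instance : AddCommGroup (UnitalK1 B) where
  add_assoc a b c := by
    induction a using Quot.ind; induction b using Quot.ind; induction c using Quot.ind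
    refine UnitalK1.mk_eq_of_reindex (Equiv.sumAssoc _ _ _) ?_
    ext i j
    rcases i with i | i | i <;> rcases j with j | j | j <;> rfl
  zero_add a := by
    induction a using Quot.ind
    refine UnitalK1.mk_eq_of_reindex (Equiv.emptySum _ _) ?_
    ext i j; simp [Matrix.fromBlocks]
  add_zero a := by
    induction a using Quot.ind
    refine UnitalK1.mk_eq_of_reindex (Equiv.sumEmpty _ _) ?_
    ext i j; simp [Matrix.fromBlocks]
  add_comm a b := by
    induction a using Quot.ind; induction b using Quot.ind
    exact UnitaryMatrix.mk_add_comm _ _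
  neg_add_cancel a := by
    induction a using Quot.ind with
    | mk P => exact UnitalK1.mk_neg_add P.mat P.isUnitary
  nsmul := nsmulRec
  zsmul := zsmulRec

end K1

section functoriality

variable {B' : Type*} [CStarAlgebra B'] {ι : Type} [Fintype ι] [DecidableEq ι]

theorem StarAlgHom.continuous_of_complex (φ : B →⋆ₐ[ℂ] B') : Continuous φ :=
  AddMonoidHomClass.continuous_of_bound φ 1 fun x => by
    simpa using NonUnitalStarAlgHom.norm_apply_le φ x

theorem isStarProjection_map (φ : B →⋆ₐ[ℂ] B') {p : Matrix ι ι B} (hp : IsStarProjection p) :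
    IsStarProjection (p.map φ) := by
  refine ⟨?_, ?_⟩
  · have := hp.isIdempotentElem.eq
    rw [IsIdempotentElem, ← Matrix.map_mul, this]
  · have := hp.isSelfAdjoint.star_eq
    rw [Matrix.star_eq_conjTranspose] at this
    rw [IsSelfAdjoint, Matrix.star_eq_conjTranspose,
      ← Matrix.conjTranspose_map φ (fun x => map_star φ x), this]

/-- The monoid homomorphism `V(B) → V(B')` induced by a unital star homomorphism. -/
def V.map (φ : B →⋆ₐ[ℂ] B') : V B →+ V B' where
  toFun := Quot.lift (fun P => V.mk (P.mat.map φ) (isStarProjection_map φ P.isProj)) (by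
    intro P Q h
    cases h with
    | reindex e p hp => exact V.mk_eq_of_reindex e (by ext i j; simp)
    | @stabilize ι κ _ _ _ _ p hp =>
      refine (V.mk_stabilize (κ := κ) (p.map φ) (isStarProjection_map φ hp)).symm.trans ?_
      refine V.mk_eq_of_reindex (Equiv.refl _) ?_
      ext i j
      rcases i with i | i <;> rcases j with j | j <;> simp [Matrix.fromBlocks]
    | homotopy p q hp hq h =>
      refine V.mk_homotopy _ _ (joinedIn_map h (f := fun x => x.map φ) ?_
        fun z hz => isStarProjection_map φ hz)
      exact continuous_id.matrix_map (StarAlgHom.continuous_of_complex φ))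
  map_zero' := V.mk_eq_of_reindex (Equiv.refl _) (by ext i; exact i.elim)
  map_add' a b := by
    induction a using Quot.ind; induction b using Quot.ind
    refine V.mk_eq_of_reindex (Equiv.refl _) ?_
    ext i j
    rcases i with i | i <;> rcases j with j | j <;>
      first | rfl | exact (map_zero φ).symm

end functoriality

/-- The `K₀`-group of a unital C⋆-algebra: formal differences of classes of projections. -/
abbrev UnitalK0 (B : Type*) [CStarAlgebra B] : Type _ := Algebra.GrothendieckAddGroup (V B)

/-- Functoriality of `K₀` for unital star homomorphisms. -/
def UnitalK0.map {B' : Type*} [CStarAlgebra B'] (φ : B →⋆ₐ[ℂ] B') : UnitalK0 B →+ UnitalK0 B' :=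
  Algebra.GrothendieckAddGroup.lift (Algebra.GrothendieckAddGroup.of.comp (V.map φ))

/-- The scalar part `A⁺ → ℂ` on the unitization `A⁺` of a C⋆-algebra `A`. -/
def scalarPart (A : Type*) [NonUnitalCStarAlgebra A] : Unitization ℂ A →⋆ₐ[ℂ] ℂ :=
  { Unitization.fstHom ℂ A with map_star' := fun _ => rfl }

/-- The `K₀`-group of a not necessarily unital C⋆-algebra `A`: the kernel of the map
`K₀(A⁺) → K₀(ℂ)` induced by the scalar part. -/
def K0 (A : Type*) [NonUnitalCStarAlgebra A] : AddSubgroup (UnitalK0 (Unitization ℂ A)) :=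
  (UnitalK0.map (scalarPart A)).ker

/-- The `K₁`-group of a not necessarily unital C⋆-algebra `A`: stable homotopy classes of unitaries
in matrix algebras over the unitization `A⁺`. -/
abbrev K1 (A : Type*) [NonUnitalCStarAlgebra A] : Type _ := UnitalK1 (Unitization ℂ A)

section

variable {A : Type*} [NonUnitalCStarAlgebra A]

theorem isStarProjection_inr {p : A} (hp : IsStarProjection p) :
    IsStarProjection (Matrix.of fun _ _ : Unit => (p : Unitization ℂ A)) := by
  refine ⟨?_, ?_⟩
  · refine Matrix.ext fun i j => ?_
    simp [Matrix.mul_apply, ← Unitization.inr_mul, hp.isIdempotentElem.eq]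
  · refine Matrix.ext fun i j => ?_
    simp [Matrix.star_apply, ← Unitization.inr_star, hp.isSelfAdjoint.star_eq]

/-- The class `[p] ∈ K₀(A)` of a projection `p ∈ A`. -/
def K0.ofProjection (p : A) (hp : IsStarProjection p) : K0 A :=
  ⟨Algebra.GrothendieckAddGroup.of (V.mk _ (isStarProjection_inr hp)), by
    have : V.map (scalarPart A) (V.mk _ (isStarProjection_inr hp)) = 0 := by
      refine Eq.trans ?_ (V.mk_zero (ι := Unit))
      refine V.mk_eq_of_reindex (Equiv.refl _) ?_
      ext i j
      rfl
    rw [K0, AddMonoidHom.mem_ker, UnitalK0.map]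
    rw [show ∀ (f : V (Unitization ℂ A) →+ UnitalK0 ℂ) x, Algebra.GrothendieckAddGroup.lift f
      (Algebra.GrothendieckAddGroup.of x) = f x from fun f x => DFunLike.congr_fun
        (Algebra.GrothendieckAddGroup.lift.symm_apply_apply f) x]
    rw [AddMonoidHom.comp_apply, this, map_zero]⟩

end

section exponential

open scoped Nat

variable {B : Type*} [CStarAlgebra B] {ι κ : Type} [Fintype ι]
  [Fintype κ] [DecidableEq ι] [DecidableEq κ]

open scoped Matrix.Norms.Operator in
theorem matrix_completeSpace :
    @CompleteSpace (Matrix ι ι B) PseudoMetricSpace.toUniformSpace :=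
  (inferInstance : CompleteSpace (ι → ι → B))

theorem matrix_exp_hasSum (x : Matrix ι ι B) :
    HasSum (fun n : ℕ => (n !⁻¹ : ℂ) • x ^ n) (NormedSpace.exp x) := by
  open scoped Matrix.Norms.Operator in
  have := matrix_completeSpace (ι := ι) (B := B)
  exact NormedSpace.exp_series_hasSum_exp' x

theorem matrix_exp_continuous :
    Continuous (NormedSpace.exp : Matrix ι ι B → Matrix ι ι B) := by
  open scoped Matrix.Norms.Operator in
  have := matrix_completeSpace (ι := ι) (B := B)
  let _ : NormedAlgebra ℚ (Matrix ι ι B) := NormedAlgebra.restrictScalars ℚ ℂ _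
  exact NormedSpace.exp_continuous

theorem matrix_exp_mem_unitary {x : Matrix ι ι B} (h : star x = -x) :
    NormedSpace.exp x ∈ unitary (Matrix ι ι B) := by
  have hs : star (NormedSpace.exp x) = NormedSpace.exp (-x) := by
    rw [NormedSpace.star_exp, h]
  have hadd : ∀ y z : Matrix ι ι B, Commute y z →
      NormedSpace.exp (y + z) = NormedSpace.exp y * NormedSpace.exp z := by
    intro y z hyz
    let _ : NormedAlgebra ℚ B := NormedAlgebra.restrictScalars ℚ ℂ _
    exact Matrix.exp_add_of_commute y z hyz
  rw [Unitary.mem_iff, hs, ← hadd _ _ (Commute.refl x).neg_left,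
    ← hadd _ _ (Commute.refl x).neg_right, neg_add_cancel, add_neg_cancel, NormedSpace.exp_zero]
  exact ⟨rfl, rfl⟩

/-- A continuous linear map compatible with powers commutes with the exponential. -/
theorem matrix_exp_map {B' : Type*} [CStarAlgebra B'] (f : Matrix ι ι B →ₗ[ℂ] Matrix κ κ B')
    (hf : Continuous f) (x : Matrix ι ι B) (hx : ∀ n : ℕ, f (x ^ n) = f x ^ n) :
    f (NormedSpace.exp x) = NormedSpace.exp (f x) := by
  have h := (matrix_exp_hasSum x).map f hf
  refine h.unique ?_
  convert matrix_exp_hasSum (f x) using 2 with n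
  simp [hx]

theorem matrix_exp_reindex (e : ι ≃ κ) (x : Matrix ι ι B) :
    NormedSpace.exp (Matrix.reindex e e x) = Matrix.reindex e e (NormedSpace.exp x) := by
  refine (matrix_exp_map (Matrix.reindexAlgEquiv ℂ B e).toLinearMap ?_ x ?_).symm
  · exact continuous_id.matrix_submatrix _ _
  · intro n; exact map_pow (Matrix.reindexAlgEquiv ℂ B e) x n

theorem matrix_exp_blocks (x : Matrix ι ι B) (y : Matrix κ κ B) :
    NormedSpace.exp (Matrix.fromBlocks x 0 0 y) =
      Matrix.fromBlocks (NormedSpace.exp x) 0 0 (NormedSpace.exp y) := by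
  have hpow : ∀ n : ℕ, Matrix.fromBlocks x 0 0 y ^ n = Matrix.fromBlocks (x ^ n) 0 0 (y ^ n) := by
    intro n
    induction n with
    | zero => simp [Matrix.fromBlocks_one]
    | succ n ih => simp [pow_succ, ih, Matrix.fromBlocks_multiply]
  have h := (matrix_exp_hasSum x).prodMk (matrix_exp_hasSum y)
  have h2 := h.map (⟨⟨fun z => Matrix.fromBlocks z.1 0 0 z.2,
      by ext i j; rcases i with i | i <;> rcases j with j | j <;> simp⟩,
      fun a b => by simp [Matrix.fromBlocks_add]⟩ :
    Matrix ι ι B × Matrix κ κ B →+ Matrix (ι ⊕ κ) (ι ⊕ κ) B)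
    (Continuous.matrix_fromBlocks continuous_fst continuous_const continuous_const continuous_snd)
  refine (matrix_exp_hasSum _).unique ?_
  convert h2 using 1
  · ext1 n
    simp [hpow, Matrix.fromBlocks_smul]
  · rfl

theorem matrix_exp_idempotent (p : Matrix ι ι B) (hp : IsIdempotentElem p) :
    NormedSpace.exp ((2 * Real.pi * Complex.I : ℂ) • p) = 1 := by
  set c : ℂ := 2 * Real.pi * Complex.I with hc
  have h1 := matrix_exp_hasSum (c • p)
  have h2 : HasSum (fun n : ℕ => ((n !⁻¹ : ℂ) * c ^ n) • p) p := by
    have := (NormedSpace.exp_series_hasSum_exp' (𝕂 := ℂ) c).smul_const p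
    rw [← Complex.exp_eq_exp_ℂ, hc, Complex.exp_two_pi_mul_I, one_smul] at this
    simpa using this
  have h3 : HasSum (fun n : ℕ => if n = 0 then 1 - p else 0) (1 - p) := hasSum_ite_eq 0 (1 - p)
  have h4 := h2.add h3
  rw [add_sub_cancel] at h4
  refine h1.unique ?_
  convert h4 using 1
  ext1 n
  rcases n with _ | n
  · simp
  · simp [smul_pow, hp.pow_succ_eq, mul_smul]

end exponential
section MayerVietoris

theorem fst_sub' {A : Type*} [NonUnitalCStarAlgebra A] (x y : Unitization ℂ A) :
    (x - y).fst = x.fst - y.fst := rfl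

theorem snd_sub' {A : Type*} [NonUnitalCStarAlgebra A] (x y : Unitization ℂ A) :
    (x - y).snd = x.snd - y.snd := rfl

variable {𝔅 : Type*} [CStarAlgebra 𝔅]

/-- A C⋆-algebra `A` (inside an ambient C⋆-algebra) is decomposed into closed two-sided ideals
`I` and `J` with `A = I + J` and `I ∩ J = C`, the splitting `A = I + J` being given by a bounded
star-preserving linear map. -/
structure IsMayerVietoris (A I J C : NonUnitalStarSubalgebra ℂ 𝔅) : Prop where
  left_le : I ≤ A
  isClosed_left : IsClosed (I : Set 𝔅)
  isClosed_right : IsClosed (J : Set 𝔅)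
  mul_mem_left : ∀ a ∈ A, ∀ x ∈ I, a * x ∈ I
  mul_mem_right : ∀ a ∈ A, ∀ x ∈ J, a * x ∈ J
  mem_inter : ∀ x, x ∈ C ↔ x ∈ I ∧ x ∈ J
  exists_split : ∃ L : 𝔅 →L[ℂ] 𝔅, (∀ x, L (star x) = star (L x)) ∧
    ∀ a ∈ A, L a ∈ I ∧ a - L a ∈ J

namespace IsMayerVietoris

section

variable (A I J C : NonUnitalStarSubalgebra ℂ 𝔅) [IsClosed (A : Set 𝔅)] [IsClosed (C : Set 𝔅)]
variable {ι : Type} [Fintype ι] [DecidableEq ι]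

/-- `a` is a self-adjoint matrix over `I⁺` which agrees with `p` modulo `J`, i.e. `a` is a
self-adjoint lift to `I⁺` of the image of `p` under `A⁺ → (A / J)⁺ ≅ (I / C)⁺`. -/
def IsLift (p a : Matrix ι ι (Unitization ℂ A)) : Prop :=
  IsSelfAdjoint a ∧ ∀ i j, (a i j).fst = (p i j).fst ∧ ((a i j).snd : 𝔅) ∈ I ∧
    ((a i j).snd : 𝔅) - ((p i j).snd : 𝔅) ∈ J

/-- The matrix `u` over `C⁺` is `exp (2πi a)` for a self-adjoint lift `a` of `p`. -/
def IsExpLift (p : Matrix ι ι (Unitization ℂ A)) (u : Matrix ι ι (Unitization ℂ C)) : Prop :=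
  ∃ a, IsLift A I J p a ∧ ∀ i j,
    (u i j).fst = (NormedSpace.exp ((2 * Real.pi * Complex.I : ℂ) • a) i j).fst ∧
    ((u i j).snd : 𝔅) = ((NormedSpace.exp ((2 * Real.pi * Complex.I : ℂ) • a) i j).snd : 𝔅)

end

variable {A I J C : NonUnitalStarSubalgebra ℂ 𝔅} [IsClosed (A : Set 𝔅)] [IsClosed (C : Set 𝔅)]
variable {ι κ : Type} [Fintype ι] [DecidableEq ι] [Fintype κ] [DecidableEq κ]

theorem mul_mem_left' (h : IsMayerVietoris A I J C) {x a : 𝔅} (hx : x ∈ I) (ha : a ∈ A) :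
    x * a ∈ I := by
  have := star_mem (h.mul_mem_left _ (star_mem ha) _ (star_mem hx))
  simpa using this

theorem mul_mem_right' (h : IsMayerVietoris A I J C) {x a : 𝔅} (hx : x ∈ J) (ha : a ∈ A) :
    x * a ∈ J := by
  have := star_mem (h.mul_mem_right _ (star_mem ha) _ (star_mem hx))
  simpa using this

/-- The matrices over `A⁺` all of whose entries lie in the ideal `J`. -/
def idealMatrix (h : IsMayerVietoris A I J C) (ι : Type) [Fintype ι] [DecidableEq ι] :
    Submodule ℂ (Matrix ι ι (Unitization ℂ A)) where
  carrier := {m | ∀ i j, (m i j).fst = 0 ∧ ((m i j).snd : 𝔅) ∈ J}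
  add_mem' ha hb i j := ⟨by simp [(ha i j).1, (hb i j).1],
    by simpa using add_mem (ha i j).2 (hb i j).2⟩
  zero_mem' i j := ⟨rfl, by simp⟩
  smul_mem' c m hm i j := ⟨by simp [(hm i j).1], by simpa using SMulMemClass.smul_mem c (hm i j).2⟩

theorem isClosed_idealMatrix (h : IsMayerVietoris A I J C) :
    IsClosed (h.idealMatrix ι : Set (Matrix ι ι (Unitization ℂ A))) := by
  have : (h.idealMatrix ι : Set (Matrix ι ι (Unitization ℂ A))) =
      ⋂ i, ⋂ j, {m | (m i j).fst = 0 ∧ ((m i j).snd : 𝔅) ∈ J} := by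
    ext m; simp [idealMatrix]
  rw [this]
  refine isClosed_iInter fun i => isClosed_iInter fun j => IsClosed.inter ?_ ?_
  · exact isClosed_eq (Unitization.continuous_fst.comp (continuous_id.matrix_elem i j))
      continuous_const
  · exact h.isClosed_right.preimage (continuous_subtype_val.comp
      (Unitization.continuous_snd.comp (continuous_id.matrix_elem i j)))

theorem idealMatrix_mul_left (h : IsMayerVietoris A I J C) (x : Matrix ι ι (Unitization ℂ A))
    {m : Matrix ι ι (Unitization ℂ A)} (hm : m ∈ h.idealMatrix ι) : x * m ∈ h.idealMatrix ι := by
  intro i j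
  rw [Matrix.mul_apply]
  refine Finset.sum_induction _
    (fun y : Unitization ℂ A => y.fst = 0 ∧ (y.snd : 𝔅) ∈ J) ?_ ?_ ?_
  · rintro a b ⟨h1, h2⟩ ⟨h3, h4⟩
    exact ⟨by simp [h1, h3], by simpa using add_mem h2 h4⟩
  · exact ⟨rfl, by simp⟩
  · intro k _
    obtain ⟨h1, h2⟩ := hm k j
    refine ⟨by simp [h1], ?_⟩
    simp only [Unitization.snd_mul, h1, zero_smul, add_zero]
    exact add_mem (SMulMemClass.smul_mem (s := J) _ h2) (h.mul_mem_right _ (x i k).snd.2 _ h2)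

theorem idealMatrix_mul_right (h : IsMayerVietoris A I J C) (x : Matrix ι ι (Unitization ℂ A))
    {m : Matrix ι ι (Unitization ℂ A)} (hm : m ∈ h.idealMatrix ι) : m * x ∈ h.idealMatrix ι := by
  intro i j
  rw [Matrix.mul_apply]
  refine Finset.sum_induction _
    (fun y : Unitization ℂ A => y.fst = 0 ∧ (y.snd : 𝔅) ∈ J) ?_ ?_ ?_
  · rintro a b ⟨h1, h2⟩ ⟨h3, h4⟩
    exact ⟨by simp [h1, h3], by simpa using add_mem h2 h4⟩
  · exact ⟨rfl, by simp⟩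
  · intro k _
    obtain ⟨h1, h2⟩ := hm i k
    refine ⟨by simp [h1], ?_⟩
    simp only [Unitization.snd_mul, h1, zero_smul, zero_add]
    exact add_mem (SMulMemClass.smul_mem (s := J) _ h2) (h.mul_mem_right' h2 (x k j).snd.2)

/-- The matrices over `A⁺` which have entries in `I⁺`. -/
def leftMatrix (h : IsMayerVietoris A I J C) (ι : Type) [Fintype ι] [DecidableEq ι] :
    Subalgebra ℂ (Matrix ι ι (Unitization ℂ A)) where
  carrier := {m | ∀ i j, ((m i j).snd : 𝔅) ∈ I}
  add_mem' ha hb i j := by simpa using add_mem (ha i j) (hb i j)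
  mul_mem' := by
    intro x m hx hm i j
    rw [Matrix.mul_apply]
    refine Finset.sum_induction _ (fun y : Unitization ℂ A => (y.snd : 𝔅) ∈ I) ?_ ?_ ?_
    · intro a b h2 h4
      simpa using add_mem h2 h4
    · simp
    · intro k _
      simp only [Unitization.snd_mul]
      exact add_mem (add_mem (SMulMemClass.smul_mem (s := I) _ (hm k j))
        (SMulMemClass.smul_mem (s := I) _ (hx i k))) (mul_mem (hx i k) (hm k j))
  algebraMap_mem' r i j := by
    rw [Matrix.algebraMap_matrix_apply]
    split_ifs
    · exact zero_mem I
    · exact zero_mem I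

theorem isClosed_leftMatrix (h : IsMayerVietoris A I J C) :
    IsClosed (h.leftMatrix ι : Set (Matrix ι ι (Unitization ℂ A))) := by
  have : (h.leftMatrix ι : Set (Matrix ι ι (Unitization ℂ A))) =
      ⋂ i, ⋂ j, {m | ((m i j).snd : 𝔅) ∈ I} := by
    ext m; simp [leftMatrix]
  rw [this]
  refine isClosed_iInter fun i => isClosed_iInter fun j => ?_
  exact h.isClosed_left.preimage (continuous_subtype_val.comp
      (Unitization.continuous_snd.comp (continuous_id.matrix_elem i j)))

theorem isLift_iff (h : IsMayerVietoris A I J C) {p a : Matrix ι ι (Unitization ℂ A)} :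
    IsLift A I J p a ↔ IsSelfAdjoint a ∧ a ∈ h.leftMatrix ι ∧ a - p ∈ h.idealMatrix ι := by
  constructor
  · rintro ⟨h1, h2⟩
    exact ⟨h1, fun i j => (h2 i j).2.1, fun i j =>
      ⟨sub_eq_zero.2 (h2 i j).1, (h2 i j).2.2⟩⟩
  · rintro ⟨h1, h2, h3⟩
    exact ⟨h1, fun i j => ⟨sub_eq_zero.1 (h3 i j).1, h2 i j, (h3 i j).2⟩⟩

/-- For a lift `a` of a projection, `exp (2πi a)` has entries in `C⁺`. -/
theorem exp_lift_mem (h : IsMayerVietoris A I J C) {p a : Matrix ι ι (Unitization ℂ A)}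
    (hp : IsStarProjection p) (ha : IsLift A I J p a) (i j : ι) :
    ((NormedSpace.exp ((2 * Real.pi * Complex.I : ℂ) • a) i j).snd : 𝔅) ∈ C := by
  set c : ℂ := 2 * Real.pi * Complex.I with hc
  rw [h.mem_inter]
  constructor
  · have hmem : a ∈ h.leftMatrix ι := fun i j => (ha.2 i j).2.1
    have hs := matrix_exp_hasSum (c • a)
    have : NormedSpace.exp (c • a) ∈ h.leftMatrix ι := by
      rw [← hs.tsum_eq]
      exact tsum_mem h.isClosed_leftMatrix fun n =>
        Subalgebra.smul_mem _ (pow_mem (Subalgebra.smul_mem _ hmem c) n) _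
    exact this i j
  · have hsub : a - p ∈ h.idealMatrix ι := fun i j =>
      ⟨by simp [fst_sub', (ha.2 i j).1], by simpa [snd_sub'] using (ha.2 i j).2.2⟩
    have hpow : ∀ n : ℕ, a ^ n - p ^ n ∈ h.idealMatrix ι := by
      intro n
      induction n with
      | zero => simp
      | succ n ih =>
        have : a ^ (n + 1) - p ^ (n + 1) = a ^ n * (a - p) + (a ^ n - p ^ n) * p := by
          simp only [pow_succ]; noncomm_ring
        rw [this]
        exact add_mem (h.idealMatrix_mul_left _ hsub) (h.idealMatrix_mul_right _ ih)
    have hs := (matrix_exp_hasSum (c • a)).sub (matrix_exp_hasSum (c • p))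
    rw [matrix_exp_idempotent p hp.isIdempotentElem] at hs
    have hmem : NormedSpace.exp (c • a) - 1 ∈ h.idealMatrix ι := by
      rw [← hs.tsum_eq]
      refine tsum_mem h.isClosed_idealMatrix fun n => ?_
      rw [← smul_sub, smul_pow, smul_pow, ← smul_sub]
      exact Submodule.smul_mem _ _ (Submodule.smul_mem _ _ (hpow n))
    have := (hmem i j).2
    by_cases hij : i = j
    · subst hij; simpa [snd_sub'] using this
    · simpa [snd_sub', Matrix.one_apply, hij] using this

/-- The matrix over `C⁺` underlying a matrix over `A⁺` with entries in `C⁺`. -/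
def descend (x : Matrix ι ι (Unitization ℂ A)) (hx : ∀ i j, ((x i j).snd : 𝔅) ∈ C) :
    Matrix ι ι (Unitization ℂ C) :=
  Matrix.of fun i j => Unitization.inl (x i j).fst + Unitization.inr ⟨_, hx i j⟩

theorem inter_le (h : IsMayerVietoris A I J C) : C ≤ A :=
  fun x hx => h.left_le ((h.mem_inter x).1 hx).1

theorem map_descend (h : IsMayerVietoris A I J C) (x : Matrix ι ι (Unitization ℂ A))
    (hx : ∀ i j, ((x i j).snd : 𝔅) ∈ C) :
    (descend x hx).map (Unitization.starMap (NonUnitalStarSubalgebra.inclusion h.inter_le)) = x := by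
  refine Matrix.ext fun i j => ?_
  simp only [descend, Matrix.map_apply, Matrix.of_apply, map_add, Unitization.starMap_inl,
    Unitization.starMap_inr]
  exact Unitization.ext (by simp [Unitization.algebraMap_eq_inl])
    (by simp [Unitization.algebraMap_eq_inl])

theorem descend_mem_unitary (h : IsMayerVietoris A I J C) (x : Matrix ι ι (Unitization ℂ A))
    (hx : ∀ i j, ((x i j).snd : 𝔅) ∈ C) (hu : x ∈ unitary (Matrix ι ι (Unitization ℂ A))) :
    descend x hx ∈ unitary (Matrix ι ι (Unitization ℂ C)) := by
  set φ := Unitization.starMap (R := ℂ) (NonUnitalStarSubalgebra.inclusion h.inter_le) with hφ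
  have hinj : Function.Injective φ :=
    Unitization.starMap_injective (NonUnitalStarSubalgebra.inclusion_injective h.inter_le)
  have hmap : (descend x hx).map φ = x := h.map_descend x hx
  have hstar : (star (descend x hx)).map φ = star x := by
    rw [Matrix.star_eq_conjTranspose, Matrix.conjTranspose_map φ (fun y => map_star φ y), hmap,
      Matrix.star_eq_conjTranspose]
  have hone : (1 : Matrix ι ι (Unitization ℂ C)).map φ = 1 :=
    Matrix.map_one φ (map_zero φ) (map_one φ)
  rw [Unitary.mem_iff] at hu ⊢
  constructor
  · refine Matrix.map_injective hinj ?_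
    change Matrix.map _ φ = Matrix.map _ φ
    rw [hone, Matrix.map_mul, hstar, hmap, hu.1]
  · refine Matrix.map_injective hinj ?_
    change Matrix.map _ φ = Matrix.map _ φ
    rw [hone, Matrix.map_mul, hstar, hmap, hu.2]

theorem star_two_pi_smul {a : Matrix ι ι (Unitization ℂ A)} (ha : IsSelfAdjoint a) :
    star ((2 * Real.pi * Complex.I : ℂ) • a) = -((2 * Real.pi * Complex.I : ℂ) • a) := by
  rw [star_smul, ha.star_eq, ← neg_smul]
  congr 1
  simp

/-- The self-adjoint lift of a matrix over `A⁺` given by a bounded linear splitting. -/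
def splitMatrix (h : IsMayerVietoris A I J C) (L : 𝔅 →L[ℂ] 𝔅)
    (hL : ∀ a ∈ A, L a ∈ I ∧ a - L a ∈ J) (p : Matrix ι ι (Unitization ℂ A)) :
    Matrix ι ι (Unitization ℂ A) :=
  Matrix.of fun i j => Unitization.inl (p i j).fst +
    Unitization.inr ⟨L (p i j).snd, h.left_le (hL _ (p i j).snd.2).1⟩

theorem isLift_splitMatrix (h : IsMayerVietoris A I J C) (L : 𝔅 →L[ℂ] 𝔅)
    (hL : ∀ a ∈ A, L a ∈ I ∧ a - L a ∈ J) (hs : ∀ x, L (star x) = star (L x))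
    {p : Matrix ι ι (Unitization ℂ A)} (hp : IsStarProjection p) :
    IsLift A I J p (h.splitMatrix L hL p) := by
  refine ⟨Matrix.ext fun i j => ?_, fun i j => ⟨by simp [splitMatrix], ?_, ?_⟩⟩
  · have hij : star (p j i) = p i j := by
      have := congrFun (congrFun hp.isSelfAdjoint.star_eq i) j
      rwa [Matrix.star_apply] at this
    simp only [splitMatrix, Matrix.star_apply, Matrix.of_apply]
    refine Unitization.ext ?_ (Subtype.ext ?_)
    · have := congrArg (fun z : Unitization ℂ A => z.fst) hij
      simpa using this
    · have := congrArg (fun z : Unitization ℂ A => (z.snd : 𝔅)) hij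
      simpa [← hs] using congrArg L this
  · simpa [splitMatrix] using (hL _ (p i j).snd.2).1
  · have := neg_mem (hL _ (p i j).snd.2).2
    simpa [splitMatrix] using this

theorem continuous_splitMatrix (h : IsMayerVietoris A I J C) (L : 𝔅 →L[ℂ] 𝔅)
    (hL : ∀ a ∈ A, L a ∈ I ∧ a - L a ∈ J) :
    Continuous (h.splitMatrix L hL : Matrix ι ι (Unitization ℂ A) → _) := by
  refine continuous_matrix fun i j => ?_
  refine Continuous.add ?_ ?_
  · exact (Unitization.uniformEquivProd (𝕜 := ℂ) (A := A)).symm.continuous.comp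
      ((Unitization.continuous_fst.comp (continuous_id.matrix_elem i j)).prodMk
        (continuous_const (y := (0 : A))))
  · exact Unitization.continuous_inr.comp (Continuous.subtype_mk (L.continuous.comp
      (continuous_subtype_val.comp
        (Unitization.continuous_snd.comp (continuous_id.matrix_elem i j)))) _)

theorem continuous_descend {T : Type*} [TopologicalSpace T]
    {f : T → Matrix ι ι (Unitization ℂ A)} (hf : Continuous f)
    (hx : ∀ t i j, ((f t i j).snd : 𝔅) ∈ C) :
    Continuous fun t => descend (f t) (hx t) := by
  refine continuous_matrix fun i j => ?_
  refine Continuous.add ?_ ?_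
  · exact (Unitization.uniformEquivProd (𝕜 := ℂ) (A := C)).symm.continuous.comp
      ((Unitization.continuous_fst.comp (hf.matrix_elem i j)).prodMk
        (continuous_const (y := (0 : C))))
  · exact Unitization.continuous_inr.comp (Continuous.subtype_mk
      (continuous_subtype_val.comp (Unitization.continuous_snd.comp (hf.matrix_elem i j))) _)

theorem eq_descend {x : Matrix ι ι (Unitization ℂ A)} {hx : ∀ i j, ((x i j).snd : 𝔅) ∈ C}
    {u : Matrix ι ι (Unitization ℂ C)}
    (hu : ∀ i j, (u i j).fst = (x i j).fst ∧ ((u i j).snd : 𝔅) = ((x i j).snd : 𝔅)) :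
    descend x hx = u := by
  refine Matrix.ext fun i j => Unitization.ext ?_ (Subtype.ext ?_)
  · simp [descend, (hu i j).1]
  · simp [descend, (hu i j).2]

/-- A norm-continuous path of lifts of a path of projections gives a homotopy of unitaries. -/
theorem joinedIn_of_isExpLift (h : IsMayerVietoris A I J C)
    {p q : Matrix ι ι (Unitization ℂ A)} (hp : IsStarProjection p) (hq : IsStarProjection q)
    (hpq : JoinedIn {x : Matrix ι ι (Unitization ℂ A) | IsStarProjection x} p q)
    {u v : Matrix ι ι (Unitization ℂ C)} (hu : IsExpLift A I J C p u)
    (hv : IsExpLift A I J C q v) :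
    JoinedIn (unitary (Matrix ι ι (Unitization ℂ C)) : Set (Matrix ι ι (Unitization ℂ C))) u v := by
  obtain ⟨γ, hγ⟩ := hpq
  obtain ⟨a, ha, hau⟩ := hu
  obtain ⟨b, hb, hbv⟩ := hv
  obtain ⟨L, hs, hL⟩ := h.exists_split
  let c : ℂ := 2 * Real.pi * Complex.I
  let S : Matrix ι ι (Unitization ℂ A) → Matrix ι ι (Unitization ℂ A) := h.splitMatrix L hL
  have hS : ∀ x, IsStarProjection x → IsLift A I J x (S x) :=
    fun x hx => h.isLift_splitMatrix L hL hs hx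
  let f : unitInterval → Matrix ι ι (Unitization ℂ A) := fun t =>
    S (γ t) + ((1 - (t : ℝ) : ℝ) : ℂ) • (a - S p) + ((t : ℝ) : ℂ) • (b - S q)
  have hf : Continuous f := by
    have h1 : Continuous fun t => S (γ t) := (h.continuous_splitMatrix L hL).comp γ.continuous
    have h2 : Continuous fun t : unitInterval => ((1 - (t : ℝ) : ℝ) : ℂ) :=
      Complex.continuous_ofReal.comp (continuous_const.sub continuous_subtype_val)
    have h3 : Continuous fun t : unitInterval => ((t : ℝ) : ℂ) :=
      Complex.continuous_ofReal.comp continuous_subtype_val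
    exact (h1.add (h2.smul continuous_const)).add (h3.smul continuous_const)
  have hlift : ∀ t, IsLift A I J (γ t) (f t) := by
    intro t
    have h0 := h.isLift_iff.1 (hS _ (hγ t))
    have h1 := h.isLift_iff.1 (hS _ hp)
    have h2 := h.isLift_iff.1 (hS _ hq)
    have ha' := h.isLift_iff.1 ha
    have hb' := h.isLift_iff.1 hb
    refine h.isLift_iff.2 ⟨?_, ?_, ?_⟩
    · have e1 : IsSelfAdjoint (((1 - (t : ℝ) : ℝ) : ℂ)) := Complex.conj_ofReal _
      have e2 : IsSelfAdjoint (((t : ℝ) : ℂ)) := Complex.conj_ofReal _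
      exact (h0.1.add (e1.smul (ha'.1.sub h1.1))).add (e2.smul (hb'.1.sub h2.1))
    · exact add_mem (add_mem h0.2.1 (Subalgebra.smul_mem _ (sub_mem ha'.2.1 h1.2.1) _))
        (Subalgebra.smul_mem _ (sub_mem hb'.2.1 h2.2.1) _)
    · have := add_mem (add_mem h0.2.2 (Submodule.smul_mem _ ((1 - (t : ℝ) : ℝ) : ℂ)
        (sub_mem ha'.2.2 h1.2.2))) (Submodule.smul_mem _ ((t : ℝ) : ℂ) (sub_mem hb'.2.2 h2.2.2))
      rw [sub_sub_sub_cancel_right, sub_sub_sub_cancel_right] at this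
      have e : f t - γ t = S (γ t) - γ t + ((1 - (t : ℝ) : ℝ) : ℂ) • (a - S p) +
          ((t : ℝ) : ℂ) • (b - S q) := by
        simp only [f]; abel
      rw [e]; exact this
  have hcf : Continuous fun t => c • f t := (continuous_const (y := c)).smul hf
  have hexp : Continuous fun t => NormedSpace.exp (c • f t) :=
    (matrix_exp_continuous (B := Unitization ℂ A) (ι := ι)).comp hcf
  have hmem : ∀ t i j, ((NormedSpace.exp (c • f t) i j).snd : 𝔅) ∈ C :=
    fun t => h.exp_lift_mem (hγ t) (hlift t)
  have hf0 : f 0 = a := by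
    have e : ((1 - ((0 : unitInterval) : ℝ) : ℝ) : ℂ) = 1 := by simp
    have e' : (((0 : unitInterval) : ℝ) : ℂ) = 0 := by simp
    change S (γ 0) + _ • (a - S p) + _ • (b - S q) = a
    rw [γ.source, e, e', one_smul, zero_smul, add_zero, add_sub_cancel]
  have hf1 : f 1 = b := by
    have e : ((1 - ((1 : unitInterval) : ℝ) : ℝ) : ℂ) = 0 := by simp
    have e' : (((1 : unitInterval) : ℝ) : ℂ) = 1 := by simp
    change S (γ 1) + _ • (a - S p) + _ • (b - S q) = b
    rw [γ.target, e, e', one_smul, zero_smul, add_zero, add_sub_cancel]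
  refine ⟨⟨⟨fun t => descend (NormedSpace.exp (c • f t)) (hmem t), ?_⟩, ?_, ?_⟩, ?_⟩
  · exact continuous_descend hexp hmem
  · refine eq_descend fun i j => ?_
    rw [hf0]; exact hau i j
  · refine eq_descend fun i j => ?_
    rw [hf1]; exact hbv i j
  · intro t
    exact h.descend_mem_unitary _ _ (matrix_exp_mem_unitary (star_two_pi_smul (hlift t).1))

theorem exists_isExpLift (h : IsMayerVietoris A I J C) {p : Matrix ι ι (Unitization ℂ A)}
    (hp : IsStarProjection p) :
    ∃ u ∈ unitary (Matrix ι ι (Unitization ℂ C)), IsExpLift A I J C p u := by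
  obtain ⟨L, hs, hL⟩ := h.exists_split
  have hl := h.isLift_splitMatrix L hL hs hp
  exact ⟨descend _ (h.exp_lift_mem hp hl),
    h.descend_mem_unitary _ _ (matrix_exp_mem_unitary (star_two_pi_smul hl.1)),
    _, hl, fun i j => ⟨by simp [descend], by simp [descend]⟩⟩

/-- The class of `exp (2πi a)` in `K₁(C)`, where `a` is any self-adjoint lift of the
projection `p`. -/
def expClass (h : IsMayerVietoris A I J C) (p : Matrix ι ι (Unitization ℂ A))
    (hp : IsStarProjection p) : K1 C :=
  UnitalK1.mk (h.exists_isExpLift hp).choose (h.exists_isExpLift hp).choose_spec.1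

theorem expClass_eq (h : IsMayerVietoris A I J C) {p : Matrix ι ι (Unitization ℂ A)}
    (hp : IsStarProjection p) {u : Matrix ι ι (Unitization ℂ C)}
    (hu : u ∈ unitary (Matrix ι ι (Unitization ℂ C))) (hpu : IsExpLift A I J C p u) :
    h.expClass p hp = UnitalK1.mk u hu :=
  UnitalK1.mk_homotopy _ _ (h.joinedIn_of_isExpLift hp hp (JoinedIn.refl hp)
    (h.exists_isExpLift hp).choose_spec.2 hpu)

theorem IsLift.reindex {p a : Matrix ι ι (Unitization ℂ A)} (ha : IsLift A I J p a) (e : ι ≃ κ) :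
    IsLift A I J (Matrix.reindex e e p) (Matrix.reindex e e a) := by
  refine ⟨?_, fun i j => ha.2 _ _⟩
  have := ha.1.star_eq
  rw [Matrix.star_eq_conjTranspose] at this
  simp [IsSelfAdjoint, Matrix.star_eq_conjTranspose, this]

theorem IsLift.blocks {p a : Matrix ι ι (Unitization ℂ A)} (ha : IsLift A I J p a)
    {q b : Matrix κ κ (Unitization ℂ A)} (hb : IsLift A I J q b) :
    IsLift A I J (Matrix.fromBlocks p 0 0 q) (Matrix.fromBlocks a 0 0 b) := by
  refine ⟨?_, fun i j => ?_⟩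
  · have h1 := ha.1.star_eq
    have h2 := hb.1.star_eq
    rw [Matrix.star_eq_conjTranspose] at h1 h2
    simp [IsSelfAdjoint, Matrix.star_eq_conjTranspose, Matrix.fromBlocks_conjTranspose, h1, h2]
  · rcases i with i | i <;> rcases j with j | j
    · exact ha.2 i j
    · simp
    · simp
    · exact hb.2 i j

theorem IsExpLift.reindex {p : Matrix ι ι (Unitization ℂ A)} {u : Matrix ι ι (Unitization ℂ C)}
    (hu : IsExpLift A I J C p u) (e : ι ≃ κ) :
    IsExpLift A I J C (Matrix.reindex e e p) (Matrix.reindex e e u) := by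
  obtain ⟨a, ha, hau⟩ := hu
  refine ⟨_, ha.reindex e, fun i j => ?_⟩
  have : (2 * Real.pi * Complex.I : ℂ) • Matrix.reindex e e a =
      Matrix.reindex e e ((2 * Real.pi * Complex.I : ℂ) • a) := rfl
  rw [this, matrix_exp_reindex]
  exact hau _ _

theorem IsExpLift.blocks {p : Matrix ι ι (Unitization ℂ A)} {u : Matrix ι ι (Unitization ℂ C)}
    (hu : IsExpLift A I J C p u) {q : Matrix κ κ (Unitization ℂ A)}
    {v : Matrix κ κ (Unitization ℂ C)} (hv : IsExpLift A I J C q v) :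
    IsExpLift A I J C (Matrix.fromBlocks p 0 0 q) (Matrix.fromBlocks u 0 0 v) := by
  obtain ⟨a, ha, hau⟩ := hu
  obtain ⟨b, hb, hbv⟩ := hv
  refine ⟨_, ha.blocks hb, fun i j => ?_⟩
  rw [Matrix.fromBlocks_smul, smul_zero, smul_zero, matrix_exp_blocks]
  rcases i with i | i <;> rcases j with j | j
  · exact hau i j
  · simp
  · simp
  · exact hbv i j

theorem isExpLift_zero : IsExpLift A I J C (0 : Matrix ι ι (Unitization ℂ A)) 1 := by
  refine ⟨0, ⟨.zero _, fun i j => by simp⟩, fun i j => ?_⟩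
  rw [smul_zero, NormedSpace.exp_zero]
  by_cases hij : i = j
  · subst hij; simp
  · simp [hij]

/-- The homomorphism `V(A⁺) → K₁(C)` sending the class of a projection `p` to the class of
`exp (2πi a)`, for `a` a self-adjoint lift of `p`. -/
def expV (h : IsMayerVietoris A I J C) : V (Unitization ℂ A) →+ K1 C where
  toFun := Quot.lift (fun P => h.expClass P.mat P.isProj) (by
    intro P Q hPQ
    cases hPQ with
    | reindex e p hp =>
      obtain ⟨u, hu, hpu⟩ := h.exists_isExpLift hp
      change h.expClass p hp = h.expClass _ (isStarProjection_reindex hp e)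
      rw [h.expClass_eq hp hu hpu, h.expClass_eq _ (unitary_reindex hu e) (hpu.reindex e)]
      exact UnitalK1.mk_eq_of_reindex e rfl
    | @stabilize ι κ _ _ _ _ p hp =>
      obtain ⟨u, hu, hpu⟩ := h.exists_isExpLift hp
      change h.expClass p hp = h.expClass _ (isStarProjection_blocks hp (.zero _))
      rw [h.expClass_eq hp hu hpu, h.expClass_eq (ι := ι ⊕ κ) _ (unitary_blocks hu (one_mem _))
        (hpu.blocks isExpLift_zero)]
      exact (UnitalK1.mk_stabilize u hu).symm
    | homotopy p q hp hq hpq =>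
      obtain ⟨u, hu, hpu⟩ := h.exists_isExpLift hp
      obtain ⟨v, hv, hqv⟩ := h.exists_isExpLift hq
      change h.expClass p hp = h.expClass q hq
      rw [h.expClass_eq hp hu hpu, h.expClass_eq hq hv hqv]
      exact UnitalK1.mk_homotopy _ _ (h.joinedIn_of_isExpLift hp hq hpq hpu hqv))
  map_zero' := by
    refine (h.expClass_eq (ι := Empty) (.zero _) (one_mem _) isExpLift_zero).trans ?_
    exact UnitalK1.mk_one
  map_add' x y := by
    induction x using Quot.ind with
    | mk P =>
    induction y using Quot.ind with
    | mk Q =>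
      obtain ⟨u, hu, hpu⟩ := h.exists_isExpLift P.isProj
      obtain ⟨v, hv, hqv⟩ := h.exists_isExpLift Q.isProj
      change h.expClass _ (isStarProjection_blocks P.isProj Q.isProj) =
        h.expClass P.mat P.isProj + h.expClass Q.mat Q.isProj
      rw [h.expClass_eq P.isProj hu hpu, h.expClass_eq Q.isProj hv hqv,
        h.expClass_eq (ι := P.ι ⊕ Q.ι) _ (unitary_blocks hu hv) (hpu.blocks hqv)]
      rfl

/-- The Mayer–Vietoris boundary map `∂ : K₀(A) → K₁(I ∩ J)`, i.e. the composition
`K₀(A) → K₀(A / J) ≅ K₀(I / (I ∩ J)) → K₁(I ∩ J)` whose last arrow is the exponential map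
`[q] ↦ [exp (2πi a)]`, `a` a self-adjoint lift of the projection `q`. -/
def boundary (h : IsMayerVietoris A I J C) : K0 A →+ K1 C :=
  (Algebra.GrothendieckAddGroup.lift h.expV).comp (K0 A).subtype

end IsMayerVietoris

end MayerVietoris

end KTheory

namespace Coarse

open scoped ZeroAtInfty

section XModule

variable (X : Type*) [MetricSpace X]
variable (ℋ : Type*) [NormedAddCommGroup ℋ] [InnerProductSpace ℂ ℋ] [CompleteSpace ℋ]

/-- An `X`-module structure on the Hilbert space `ℋ`: a (nondegenerate) action of `C₀(X)`. -/
structure XModule where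
  rep : C₀(X, ℂ) →⋆ₙₐ[ℂ] (ℋ →L[ℂ] ℋ)
  nondegenerate : (Submodule.span ℂ {w : ℋ | ∃ f v, rep f v = w}).topologicalClosure = ⊤

end XModule

variable {X : Type*} [MetricSpace X]
variable {ℋ : Type*} [NormedAddCommGroup ℋ] [InnerProductSpace ℂ ℋ] [CompleteSpace ℋ]

namespace XModule

variable (M : XModule X ℋ)

/-- The module is ample if only the zero function acts as a compact operator. -/
def IsAmple : Prop := ∀ f : C₀(X, ℂ), IsCompactOperator (M.rep f) → f = 0

/-- For `U` open, the range of the spectral projection `χ_U`: the closed span of the ranges of all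
`f ∈ C₀(X)` vanishing outside `U`. -/
def openSubspace (U : Set X) : Submodule ℂ ℋ :=
  (Submodule.span ℂ
    {w : ℋ | ∃ f : C₀(X, ℂ), (∀ x ∉ U, f x = 0) ∧ ∃ v, M.rep f v = w}).topologicalClosure

/-- The range of the spectral projection `χ_W` for a Borel set `W`. Since the spectral measure of
the representation is outer regular, it is the intersection of the ranges of `χ_U` over all
open `U ⊇ W`. -/
def spectralSubspace (W : Set X) : Submodule ℂ ℋ :=
  ⨅ U : {U : Set X // IsOpen U ∧ W ⊆ U}, M.openSubspace U

theorem isClosed_openSubspace (U : Set X) : IsClosed (M.openSubspace U : Set ℋ) :=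
  Submodule.isClosed_topologicalClosure _

theorem isClosed_spectralSubspace (W : Set X) : IsClosed (M.spectralSubspace W : Set ℋ) := by
  rw [spectralSubspace, Submodule.coe_iInf]
  exact isClosed_iInter fun U => M.isClosed_openSubspace U

instance (U : Set X) : CompleteSpace (M.openSubspace U) :=
  (M.isClosed_openSubspace U).completeSpace_coe

instance (W : Set X) : CompleteSpace (M.spectralSubspace W) :=
  (M.isClosed_spectralSubspace W).completeSpace_coe

/-- The action of the indicator function of the Borel set `W` on `ℋ`, i.e. the value at `W` of the
spectral measure extending the action of `C₀(X)`. -/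
def chi (W : Set X) : ℋ →L[ℂ] ℋ := (M.spectralSubspace W).starProjection

/-- `T` is locally compact if `χ_W T` and `T χ_W` are compact for all bounded Borel sets `W`. -/
def LocallyCompact (T : ℋ →L[ℂ] ℋ) : Prop :=
  ∀ W : Set X, @MeasurableSet X (borel X) W → Bornology.IsBounded W →
    IsCompactOperator (M.chi W * T) ∧ IsCompactOperator (T * M.chi W)

/-- `T` has finite propagation if for some `r ≥ 0` one has `χ_V T χ_W = 0` for all Borel sets with
`d(V, W) > r`. -/
def FinitePropagation (T : ℋ →L[ℂ] ℋ) : Prop :=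
  ∃ r : ℝ, 0 ≤ r ∧ ∀ V W : Set X, @MeasurableSet X (borel X) V → @MeasurableSet X (borel X) W →
    ENNReal.ofReal r < (⨅ v ∈ V, ⨅ w ∈ W, edist v w) → M.chi V * T * M.chi W = 0

section projections

/-- The spectral projection of an open set. -/
def openProj (U : Set X) : ℋ →L[ℂ] ℋ := (M.openSubspace U).starProjection

theorem openProj_mul_self (U : Set X) : M.openProj U * M.openProj U = M.openProj U :=
  (isStarProjection_starProjection (U := M.openSubspace U)).isIdempotentElem.eq

theorem star_openProj (U : Set X) : star (M.openProj U) = M.openProj U :=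
  (isStarProjection_starProjection (U := M.openSubspace U)).isSelfAdjoint.star_eq

theorem openProj_apply_eq {U : Set X} {v : ℋ} (hv : v ∈ M.openSubspace U) :
    M.openProj U v = v :=
  Submodule.starProjection_eq_self_iff.2 hv

theorem openProj_apply_mem (U : Set X) (v : ℋ) : M.openProj U v ∈ M.openSubspace U :=
  Submodule.starProjection_apply_mem _ _

theorem rep_mem_openSubspace {U : Set X} {f : C₀(X, ℂ)} (hf : ∀ x ∉ U, f x = 0) (v : ℋ) :
    M.rep f v ∈ M.openSubspace U :=
  Submodule.le_topologicalClosure _ (Submodule.subset_span ⟨f, hf, v, rfl⟩)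

theorem openSubspace_induction {U : Set X} {K : Submodule ℂ ℋ} (hK : IsClosed (K : Set ℋ))
    (h : ∀ f : C₀(X, ℂ), (∀ x ∉ U, f x = 0) → ∀ v, M.rep f v ∈ K) : M.openSubspace U ≤ K := by
  refine Submodule.topologicalClosure_minimal _ (Submodule.span_le.2 ?_) hK
  rintro _ ⟨f, hf, v, rfl⟩
  exact h f hf v

theorem mul_openProj_eq_of {U : Set X} {S T : ℋ →L[ℂ] ℋ}
    (h : ∀ f : C₀(X, ℂ), (∀ x ∉ U, f x = 0) → S * M.rep f = T * M.rep f) :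
    S * M.openProj U = T * M.openProj U := by
  ext v
  have : M.openSubspace U ≤ LinearMap.ker (S - T : ℋ →L[ℂ] ℋ).toLinearMap := by
    refine M.openSubspace_induction (S - T).isClosed_ker fun f hf w => ?_
    have := DFunLike.congr_fun (h f hf) w
    simpa [sub_eq_zero] using this
  have := this (M.openProj_apply_mem U v)
  simpa [sub_eq_zero] using this

theorem openProj_mul_rep {U : Set X} {f : C₀(X, ℂ)} (hf : ∀ x ∉ U, f x = 0) :
    M.openProj U * M.rep f = M.rep f := by
  ext v
  exact M.openProj_apply_eq (M.rep_mem_openSubspace hf v)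

theorem rep_mul_openProj {U : Set X} {f : C₀(X, ℂ)} (hf : ∀ x ∉ U, f x = 0) :
    M.rep f * M.openProj U = M.rep f := by
  have : M.openProj U * M.rep (star f) = M.rep (star f) :=
    M.openProj_mul_rep fun x hx => by simp [hf x hx]
  have := congrArg star this
  simpa [star_mul, star_openProj, ← map_star] using this

/-- An operator that commutes with the action of `C₀(X)` commutes with spectral projections. -/
theorem commute_openProj {T : ℋ →L[ℂ] ℋ} (hT : ∀ f, M.rep f * T = T * M.rep f) (U : Set X) :
    M.openProj U * T = T * M.openProj U := by
  have key : ∀ S : ℋ →L[ℂ] ℋ, (∀ f, M.rep f * S = S * M.rep f) →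
      M.openProj U * S * M.openProj U = S * M.openProj U := by
    intro S hS
    refine M.mul_openProj_eq_of fun f hf => ?_
    rw [mul_assoc, ← hS, ← mul_assoc, M.openProj_mul_rep hf]
  have h1 := key T hT
  have h2 := key (star T) fun f => by
    have := congrArg star (hT (star f))
    simpa [star_mul, ← map_star] using this.symm
  have h3 := congrArg star h2
  simp only [star_mul, star_openProj, star_star, ← mul_assoc] at h3
  rw [← h3, h1]

theorem rep_comm (f g : C₀(X, ℂ)) : M.rep f * M.rep g = M.rep g * M.rep f := by
  rw [← map_mul, ← map_mul, mul_comm]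

theorem openProj_comm_rep (U : Set X) (g : C₀(X, ℂ)) :
    M.openProj U * M.rep g = M.rep g * M.openProj U :=
  M.commute_openProj (fun f => M.rep_comm f g) U

theorem openProj_comm (U V : Set X) :
    M.openProj U * M.openProj V = M.openProj V * M.openProj U :=
  M.commute_openProj (fun f => (M.openProj_comm_rep V f).symm) U

theorem openProj_mul_of_subset {U V : Set X} (h : U ⊆ V) :
    M.openProj V * M.openProj U = M.openProj U := by
  have := M.mul_openProj_eq_of (U := U) (S := M.openProj V) (T := 1) fun f hf => by
    rw [M.openProj_mul_rep fun x hx => hf x fun hxU => hx (h hxU), one_mul]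
  rwa [one_mul] at this

theorem openProj_mul_of_subset' {U V : Set X} (h : U ⊆ V) :
    M.openProj U * M.openProj V = M.openProj U := by
  rw [M.openProj_comm, M.openProj_mul_of_subset h]

theorem rep_mul_openProj_eq_zero {U : Set X} {f : C₀(X, ℂ)} (hf : ∀ x ∈ U, f x = 0) :
    M.rep f * M.openProj U = 0 := by
  have := M.mul_openProj_eq_of (U := U) (S := M.rep f) (T := 0) fun g hg => by
    rw [← map_mul, zero_mul]
    convert map_zero M.rep
    ext x
    by_cases hx : x ∈ U
    · simp [hf x hx]
    · simp [hg x hx]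
  rwa [zero_mul] at this

theorem openProj_mul_eq_zero {U : Set X} {T : ℋ →L[ℂ] ℋ}
    (h : ∀ f : C₀(X, ℂ), (∀ x ∉ U, f x = 0) → M.rep f * T = 0) : M.openProj U * T = 0 := by
  have := M.mul_openProj_eq_of (U := U) (S := star T) (T := 0) fun f hf => by
    have := congrArg star (h (star f) fun x hx => by simp [hf x hx])
    simpa [star_mul, ← map_star] using this
  have := congrArg star this
  simpa [star_mul, star_openProj] using this

theorem openProj_mul_openProj (U V : Set X) :
    M.openProj U * M.openProj V = M.openProj (U ∩ V) := by
  have h1 : M.openProj (U ∩ V) * M.openProj U * M.openProj V =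
      M.openProj U * M.openProj V := by
    refine M.mul_openProj_eq_of fun g hg => ?_
    have h2 : M.openProj (U ∩ V) * M.rep g * M.openProj U = M.rep g * M.openProj U := by
      refine M.mul_openProj_eq_of fun f hf => ?_
      rw [mul_assoc, ← map_mul]
      refine M.openProj_mul_rep fun x hx => ?_
      by_cases hxV : x ∈ V
      · simp [hf x fun hxU => hx ⟨hxU, hxV⟩]
      · simp [hg x hxV]
    rw [M.openProj_comm_rep U, ← h2, mul_assoc, mul_assoc, M.openProj_comm_rep U]
  rw [← h1, M.openProj_mul_of_subset' Set.inter_subset_left,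
    M.openProj_mul_of_subset' Set.inter_subset_right]

/-- If two open sets cover `X` then their spectral projections span. -/
theorem one_sub_mul_one_sub {U V : Set X} (hU : IsOpen U) (hV : IsOpen V)
    (h : U ∪ V = Set.univ) : (1 - M.openProj U) * (1 - M.openProj V) = 0 := by
  have hdisj : Disjoint Uᶜ Vᶜ := by
    rw [Set.disjoint_iff_inter_eq_empty, ← Set.compl_union, h, Set.compl_univ]
  obtain ⟨φ, hφU, hφV, hφ⟩ :=
    exists_continuous_zero_one_of_isClosed hU.isClosed_compl hV.isClosed_compl hdisj
  have hmul : ∀ (f : C₀(X, ℂ)) (ψ : C(X, ℝ)), (∀ x, ψ x ∈ Set.Icc (0 : ℝ) 1) →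
      ∃ g : C₀(X, ℂ), ∀ x, g x = ψ x * f x := by
    intro f ψ hψ
    refine ⟨⟨⟨fun x => ψ x * f x, by fun_prop⟩, ?_⟩, fun x => rfl⟩
    have h0 := f.zero_at_infty'
    rw [tendsto_zero_iff_norm_tendsto_zero] at h0 ⊢
    refine squeeze_zero (fun _ => norm_nonneg _) (fun x => ?_) h0
    have h1 : ‖(ψ x : ℂ)‖ ≤ 1 := by
      rw [Complex.norm_real, Real.norm_eq_abs, abs_le]
      exact ⟨by linarith [(hψ x).1], (hψ x).2⟩
    calc ‖(ψ x : ℂ) * f x‖ = ‖(ψ x : ℂ)‖ * ‖f x‖ := norm_mul _ _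
      _ ≤ 1 * ‖f x‖ := by gcongr
      _ = ‖f x‖ := one_mul _
  have hrep : ∀ f : C₀(X, ℂ), (1 - M.openProj U) * (1 - M.openProj V) * M.rep f = 0 := by
    intro f
    obtain ⟨g, hg⟩ := hmul f φ hφ
    have hgU : ∀ x ∉ U, g x = 0 := fun x hx => by
      have : φ x = 0 := hφU hx
      rw [hg, this]; simp
    have hgV : ∀ x ∉ V, (f - g) x = 0 := fun x hx => by
      have : φ x = 1 := hφV hx
      rw [ZeroAtInftyContinuousMap.sub_apply, hg, this]; simp
    have e1 : (1 - M.openProj U) * M.rep g = 0 := by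
      rw [sub_mul, one_mul, M.openProj_mul_rep hgU, sub_self]
    have e2 : (1 - M.openProj V) * M.rep (f - g) = 0 := by
      rw [sub_mul, one_mul, M.openProj_mul_rep hgV, sub_self]
    have e3 : (1 - M.openProj V) * M.rep g = M.rep g * (1 - M.openProj V) := by
      rw [sub_mul, mul_sub, M.openProj_comm_rep, one_mul, mul_one]
    have : M.rep f = M.rep g + M.rep (f - g) := by rw [← map_add, add_sub_cancel]
    rw [this, mul_add, mul_assoc, mul_assoc, e2, mul_zero, add_zero, e3, ← mul_assoc, e1, zero_mul]
  ext v
  have hle : (Submodule.span ℂ {w : ℋ | ∃ f v, M.rep f v = w}).topologicalClosure ≤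
      LinearMap.ker ((1 - M.openProj U) * (1 - M.openProj V)).toLinearMap := by
    refine Submodule.topologicalClosure_minimal _ (Submodule.span_le.2 ?_)
      (ContinuousLinearMap.isClosed_ker _)
    rintro _ ⟨f, w, rfl⟩
    exact DFunLike.congr_fun (hrep f) w
  rw [M.nondegenerate] at hle
  exact hle (Submodule.mem_top (x := v))

theorem openProj_mul_eq_self {U V : Set X} (hU : IsOpen U) (hV : IsOpen V)
    (h : U ∪ V = Set.univ) {T : ℋ →L[ℂ] ℋ} (hT : M.openProj V * T = 0) :
    M.openProj U * T = T := by
  have e : (1 - M.openProj V) * T = T := by rw [sub_mul, one_mul, hT, sub_zero]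
  have : (1 - M.openProj U) * T = 0 := by
    rw [← e, ← mul_assoc, M.one_sub_mul_one_sub hU hV h, zero_mul]
  rw [sub_mul, one_mul, sub_eq_zero] at this
  exact this.symm

theorem spectralSubspace_of_isOpen {U : Set X} (hU : IsOpen U) :
    M.spectralSubspace U = M.openSubspace U := by
  refine le_antisymm (iInf_le _ (⟨U, hU, subset_rfl⟩ : {V : Set X // IsOpen V ∧ U ⊆ V})) ?_
  refine le_iInf fun V => M.openSubspace_induction (M.isClosed_openSubspace _) fun f hf v => ?_
  exact M.rep_mem_openSubspace (fun x hx => hf x fun hxU => hx (V.2.2 hxU)) v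

theorem chi_of_isOpen {U : Set X} (hU : IsOpen U) : M.chi U = M.openProj U := by
  unfold chi openProj
  congr 1
  exact M.spectralSubspace_of_isOpen hU

theorem openProj_mul_chi {U W : Set X} (hU : IsOpen U) (h : W ⊆ U) :
    M.openProj U * M.chi W = M.chi W := by
  ext v
  refine M.openProj_apply_eq ?_
  have : M.chi W v ∈ M.spectralSubspace W := Submodule.starProjection_apply_mem _ _
  exact (iInf_le (fun U : {U : Set X // IsOpen U ∧ W ⊆ U} => M.openSubspace U) ⟨U, hU, h⟩) this

theorem chi_mul_openProj {U W : Set X} (hU : IsOpen U) (h : W ⊆ U) :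
    M.chi W * M.openProj U = M.chi W := by
  have hs : star (M.chi W) = M.chi W :=
    (isStarProjection_starProjection (U := M.spectralSubspace W)).isSelfAdjoint.star_eq
  have := congrArg star (M.openProj_mul_chi hU h)
  rwa [star_mul, star_openProj, hs] at this

end projections

end XModule

section compact

variable {ℋ : Type*} [NormedAddCommGroup ℋ] [InnerProductSpace ℂ ℋ] [CompleteSpace ℋ]

theorem isCompactOperator_star {K : ℋ →L[ℂ] ℋ} (hK : IsCompactOperator K) :
    IsCompactOperator (star K : ℋ →L[ℂ] ℋ) := by
  have hc : IsCompactOperator (K * star K) := hK.comp_clm (star K)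
  have htb : TotallyBounded ((K * star K) '' Metric.closedBall (0 : ℋ) 1) := by
    have := hc.isCompact_closure_image_closedBall (f := (K * star K).toLinearMap) 1
    exact (this.totallyBounded).subset subset_closure
  refine (isCompactOperator_iff_isCompact_closure_image_closedBall
    (star K).toLinearMap one_pos).2 ?_
  refine TotallyBounded.isCompact_of_isClosed (TotallyBounded.closure ?_) isClosed_closure
  rw [Metric.totallyBounded_iff]
  intro ε hε
  have hnet := totallyBounded_iff_subset.1 htb _
    (Metric.dist_mem_uniformity (show 0 < ε ^ 2 / 4 by positivity))
  obtain ⟨t', ht's, ht'f, ht⟩ := Set.exists_subset_image_finite_and.1 hnet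
  refine ⟨(star K : ℋ →L[ℂ] ℋ) '' t', ht'f.image _, ?_⟩
  rintro _ ⟨x, hx, rfl⟩
  have := ht ⟨x, hx, rfl⟩
  simp only [Set.mem_iUnion, Set.mem_image, exists_prop, exists_exists_and_eq_and,
    Set.mem_ofPred_eq] at this ⊢
  obtain ⟨y, hy, hxy⟩ := this
  refine ⟨y, hy, ?_⟩
  rw [Metric.mem_ball, dist_eq_norm]
  have h1 : ‖(star K) (x - y)‖ ^ 2 ≤ ‖(K * star K) (x - y)‖ * ‖x - y‖ := by
    have e : inner ℂ ((K * star K) (x - y)) (x - y) =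
        inner ℂ ((star K) (x - y)) ((star K) (x - y)) := by
      rw [mul_apply_eq_comp, ContinuousLinearMap.star_eq_adjoint,
        ContinuousLinearMap.adjoint_inner_right]
    have e2 : ((‖(star K) (x - y)‖ ^ 2 : ℝ) : ℂ) = inner ℂ ((K * star K) (x - y)) (x - y) := by
      rw [e, inner_self_eq_norm_sq_to_K]; norm_cast
    calc ‖(star K) (x - y)‖ ^ 2 = ‖((‖(star K) (x - y)‖ ^ 2 : ℝ) : ℂ)‖ := by
          rw [Complex.norm_real, Real.norm_of_nonneg (by positivity)]
      _ ≤ _ := by rw [e2]; exact norm_inner_le_norm _ _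
  have h2 : ‖(K * star K) (x - y)‖ < ε ^ 2 / 4 := by
    rw [map_sub, ← dist_eq_norm]; exact hxy
  have h3 : ‖x - y‖ ≤ 2 := by
    have hx' := mem_closedBall_zero_iff.1 hx
    have hy' := mem_closedBall_zero_iff.1 (ht's hy)
    exact (norm_sub_le _ _).trans (by linarith)
  have h4 : ‖(star K) (x - y)‖ ^ 2 < ε ^ 2 := by
    nlinarith [norm_nonneg (x - y), norm_nonneg ((K * star K) (x - y))]
  have := (sq_lt_sq₀ (norm_nonneg _) hε.le).1 h4
  rwa [map_sub] at this

end compact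

namespace XModule

variable (M : XModule X ℋ)

section propagation

theorem star_chi (W : Set X) : star (M.chi W) = M.chi W :=
  (isStarProjection_starProjection (U := M.spectralSubspace W)).isSelfAdjoint.star_eq

theorem chi_comm_openProj (W U : Set X) : M.chi W * M.openProj U = M.openProj U * M.chi W := by
  have h1 : M.chi W * (M.openProj U * M.chi W) = M.openProj U * M.chi W := by
    ext v
    refine Submodule.starProjection_eq_self_iff.2 ?_
    have hv : M.chi W v ∈ M.spectralSubspace W := Submodule.starProjection_apply_mem _ _
    rw [spectralSubspace, Submodule.mem_iInf] at hv ⊢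
    intro V
    have := DFunLike.congr_fun (M.openProj_comm U V) (M.chi W v)
    rw [mul_apply_eq_comp, mul_apply_eq_comp,
      M.openProj_apply_eq (hv V)] at this
    change M.openProj U (M.chi W v) ∈ _
    rw [this]
    exact M.openProj_apply_mem _ _
  have h2 := congrArg star h1
  simp only [star_mul, star_chi, star_openProj] at h2
  rw [← h1, ← mul_assoc, h2]

/-- The propagation of `T` is at most `r`, tested on open sets. -/
def PropLE (T : ℋ →L[ℂ] ℋ) (r : ℝ) : Prop :=
  ∀ V W : Set X, IsOpen V → IsOpen W → (∀ v ∈ V, ∀ w ∈ W, r < dist v w) →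
    M.openProj V * T * M.openProj W = 0

variable {M}

theorem PropLE.mono {T : ℋ →L[ℂ] ℋ} {r s : ℝ} (h : M.PropLE T r) (hrs : r ≤ s) :
    M.PropLE T s :=
  fun V W hV hW hd => h V W hV hW fun v hv w hw => hrs.trans_lt (hd v hv w hw)

theorem FinitePropagation.exists_propLE {T : ℋ →L[ℂ] ℋ} (h : M.FinitePropagation T) :
    ∃ r, 0 ≤ r ∧ M.PropLE T r := by
  obtain ⟨r, hr, h⟩ := h
  refine ⟨r + 1, by linarith, fun V W hV hW hd => ?_⟩
  rw [← M.chi_of_isOpen hV, ← M.chi_of_isOpen hW]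
  borelize X
  refine h V W hV.measurableSet hW.measurableSet ?_
  refine ((ENNReal.ofReal_lt_ofReal_iff (by linarith)).2 (lt_add_one r)).trans_le ?_
  refine le_iInf₂ fun v hv => le_iInf₂ fun w hw => ?_
  rw [edist_dist]
  exact ENNReal.ofReal_le_ofReal (hd v hv w hw).le

theorem PropLE.finitePropagation {T : ℋ →L[ℂ] ℋ} {r : ℝ} (hr : 0 ≤ r) (h : M.PropLE T r) :
    M.FinitePropagation T := by
  refine ⟨r + 1, by linarith, fun V W _ _ hd => ?_⟩
  have := h (Metric.thickening (1 / 2) V) (Metric.thickening (1 / 2) W)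
    Metric.isOpen_thickening Metric.isOpen_thickening ?_
  · rw [← M.chi_mul_openProj Metric.isOpen_thickening
      (Metric.self_subset_thickening (show (0 : ℝ) < 1 / 2 by norm_num) V),
      ← M.openProj_mul_chi Metric.isOpen_thickening
      (Metric.self_subset_thickening (show (0 : ℝ) < 1 / 2 by norm_num) W)]
    rw [← mul_assoc, mul_assoc (M.chi V), mul_assoc (M.chi V), this, mul_zero, zero_mul]
  · intro v hv w hw
    obtain ⟨v', hv', hvv'⟩ := Metric.mem_thickening_iff.1 hv
    obtain ⟨w', hw', hww'⟩ := Metric.mem_thickening_iff.1 hw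
    have h1 : ENNReal.ofReal (r + 1) < edist v' w' :=
      hd.trans_le ((iInf₂_le v' hv').trans (iInf₂_le w' hw'))
    rw [edist_dist] at h1
    have h2 := (ENNReal.ofReal_lt_ofReal_iff_of_nonneg (by linarith)).1 h1
    have h3 := dist_triangle4 v' v w w'
    rw [dist_comm v' v] at h3
    linarith

theorem PropLE.star {T : ℋ →L[ℂ] ℋ} {r : ℝ} (h : M.PropLE T r) : M.PropLE (star T) r := by
  intro V W hV hW hd
  have := congrArg Star.star (h W V hW hV fun w hw v hv => by rw [dist_comm]; exact hd v hv w hw)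
  simpa [star_mul, star_openProj, mul_assoc] using this

/-- An operator of propagation at most `r` spreads supports by at most `r`. -/
theorem PropLE.push {T : ℋ →L[ℂ] ℋ} {r : ℝ} (hr : 0 ≤ r) (h : M.PropLE T r) {s : ℝ}
    (hs : 0 < s) (S : Set X) :
    M.openProj (Metric.thickening (s + r + 1) S) * (T * M.openProj (Metric.thickening s S)) =
      T * M.openProj (Metric.thickening s S) := by
  refine M.openProj_mul_eq_self Metric.isOpen_thickening
    (V := (Metric.cthickening (s + r) S)ᶜ) Metric.isClosed_cthickening.isOpen_compl ?_ ?_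
  · rw [Set.eq_univ_iff_forall]
    intro x
    by_cases hx : x ∈ Metric.cthickening (s + r) S
    · exact .inl (Metric.cthickening_subset_thickening' (by linarith) (by linarith) S hx)
    · exact .inr hx
  · rw [← mul_assoc]
    refine h _ _ Metric.isClosed_cthickening.isOpen_compl Metric.isOpen_thickening ?_
    intro v hv w hw
    by_contra! hle
    refine hv ?_
    obtain ⟨z, hz, hwz⟩ := Metric.mem_thickening_iff.1 hw
    refine Metric.mem_cthickening_of_dist_le v z _ S hz ?_
    have := dist_triangle v w z
    linarith

theorem PropLE.mul {S T : ℋ →L[ℂ] ℋ} {r s : ℝ} (hr : 0 ≤ r) (hs : 0 ≤ s)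
    (hS : M.PropLE S r) (hT : M.PropLE T s) : M.PropLE (S * T) (r + (1 + s + 1)) := by
  intro V W hV hW hd
  have hW' : M.openProj (Metric.thickening 1 W) * M.openProj W = M.openProj W :=
    M.openProj_mul_of_subset (Metric.self_subset_thickening one_pos W)
  have e := hT.push hs one_pos W
  have e0 : M.openProj V * S * M.openProj (Metric.thickening (1 + s + 1) W) = 0 := by
    refine hS _ _ hV Metric.isOpen_thickening fun v hv w hw => ?_
    obtain ⟨z, hz, hwz⟩ := Metric.mem_thickening_iff.1 hw
    have := hd v hv z hz
    have := dist_triangle v w z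
    linarith
  calc M.openProj V * (S * T) * M.openProj W
      = M.openProj V * S * (T * M.openProj (Metric.thickening 1 W)) * M.openProj W := by
        rw [← hW']; simp only [mul_assoc]; rw [hW', hW']
    _ = (M.openProj V * S * M.openProj (Metric.thickening (1 + s + 1) W)) *
          (T * M.openProj (Metric.thickening 1 W)) * M.openProj W := by
        rw [← e]; simp only [mul_assoc]
        rw [← mul_assoc (M.openProj (Metric.thickening (1 + s + 1) W))
          (M.openProj (Metric.thickening (1 + s + 1) W)), M.openProj_mul_self]
    _ = 0 := by rw [e0, zero_mul, zero_mul]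

variable (M)

/-- The star algebra of locally compact operators of finite propagation. -/
def roeCore : NonUnitalStarSubalgebra ℂ (ℋ →L[ℂ] ℋ) where
  carrier := {T | M.LocallyCompact T ∧ M.FinitePropagation T}
  zero_mem' := by
    refine ⟨fun W _ _ => ?_, 0, le_rfl, fun V W _ _ _ => by simp⟩
    rw [mul_zero, zero_mul]
    exact ⟨isCompactOperator_zero, isCompactOperator_zero⟩
  add_mem' := by
    rintro S T ⟨hS, hS'⟩ ⟨hT, hT'⟩
    refine ⟨fun W hW hb => ?_, ?_⟩
    · rw [mul_add, add_mul]
      exact ⟨(hS W hW hb).1.add (hT W hW hb).1, (hS W hW hb).2.add (hT W hW hb).2⟩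
    · obtain ⟨r, hr, hS'⟩ := hS'.exists_propLE
      obtain ⟨s, hs, hT'⟩ := hT'.exists_propLE
      refine PropLE.finitePropagation (r := max r s) (hr.trans (le_max_left _ _)) ?_
      intro V W hV hW hd
      rw [mul_add, add_mul, hS'.mono (le_max_left _ _) V W hV hW hd,
        hT'.mono (le_max_right _ _) V W hV hW hd, add_zero]
  smul_mem' := by
    rintro c T ⟨hT, r, hr, hT'⟩
    refine ⟨fun W hW hb => ?_, r, hr, fun V W hV hW hd => ?_⟩
    · rw [mul_smul_comm, smul_mul_assoc]
      exact ⟨(hT W hW hb).1.smul c, (hT W hW hb).2.smul c⟩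
    · rw [mul_smul_comm, smul_mul_assoc, hT' V W hV hW hd, smul_zero]
  mul_mem' := by
    rintro S T ⟨hS, hS'⟩ ⟨hT, hT'⟩
    refine ⟨fun W hW hb => ?_, ?_⟩
    · rw [← mul_assoc, mul_assoc S]
      exact ⟨(hS W hW hb).1.comp_clm T, (hT W hW hb).2.clm_comp S⟩
    · obtain ⟨r, hr, hS'⟩ := hS'.exists_propLE
      obtain ⟨s, hs, hT'⟩ := hT'.exists_propLE
      exact (hS'.mul hr hs hT').finitePropagation (by linarith)
  star_mem' := by
    rintro T ⟨hT, hT'⟩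
    refine ⟨fun W hW hb => ?_, ?_⟩
    · have h1 := isCompactOperator_star (hT W hW hb).2
      have h2 := isCompactOperator_star (hT W hW hb).1
      rw [StarMul.star_mul (R := ℋ →L[ℂ] ℋ), star_chi] at h1 h2
      exact ⟨h1, h2⟩
    · obtain ⟨r, hr, hT'⟩ := hT'.exists_propLE
      exact hT'.star.finitePropagation hr

/-- The Roe algebra `C*_Roe(X)`: the norm closure of the locally compact operators of finite
propagation. -/
def roeAlgebra : NonUnitalStarSubalgebra ℂ (ℋ →L[ℂ] ℋ) := M.roeCore.topologicalClosure

instance : IsClosed (M.roeAlgebra : Set (ℋ →L[ℂ] ℋ)) :=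
  NonUnitalStarSubalgebra.isClosed_topologicalClosure _

theorem mul_openProj_mem_core {T : ℋ →L[ℂ] ℋ} (hT : T ∈ M.roeCore) (U : Set X) :
    T * M.openProj U ∈ M.roeCore := by
  obtain ⟨hT, hT'⟩ := hT
  refine ⟨fun W hW hb => ?_, ?_⟩
  · rw [← mul_assoc, mul_assoc T, ← chi_comm_openProj, ← mul_assoc]
    exact ⟨(hT W hW hb).1.comp_clm _, (hT W hW hb).2.comp_clm _⟩
  · obtain ⟨r, hr, hT'⟩ := hT'.exists_propLE
    refine PropLE.finitePropagation (r := r) hr fun V W hV hW hd => ?_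
    rw [mul_assoc, mul_assoc, M.openProj_comm, ← mul_assoc T, ← mul_assoc, ← mul_assoc,
      hT' V W hV hW hd, zero_mul]

/-- Right multiplication by an operator preserving a set `s` preserves its closure. -/
theorem mem_closure_of_mul_right {s t : Set (ℋ →L[ℂ] ℋ)} {D T : ℋ →L[ℂ] ℋ} (hT : T ∈ closure s)
    (h : ∀ S ∈ s, S * D ∈ t) : T * D ∈ closure t :=
  map_mem_closure (f := fun S => S * D) (continuous_id.mul continuous_const) hT h

theorem mul_openProj_mem_roe {T : ℋ →L[ℂ] ℋ} (hT : T ∈ M.roeAlgebra) (U : Set X) :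
    T * M.openProj U ∈ M.roeAlgebra :=
  mem_closure_of_mul_right hT fun _ hS => M.mul_openProj_mem_core hS U

theorem openProj_mul_mem_roe {T : ℋ →L[ℂ] ℋ} (hT : T ∈ M.roeAlgebra) (U : Set X) :
    M.openProj U * T ∈ M.roeAlgebra := by
  have := star_mem (M.mul_openProj_mem_roe (star_mem hT) U)
  simpa [star_mul, star_openProj] using this

end propagation

end XModule

/-- A big family of subsets of `X`. -/
structure BigFamily (X : Type*) [MetricSpace X] where
  sets : Set (Set X)
  nonempty : sets.Nonempty
  exists_union : ∀ Y₁ ∈ sets, ∀ Y₂ ∈ sets, ∀ r > 0, ∃ Y' ∈ sets,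
    {x | ∃ y ∈ Y₁, dist x y ≤ r} ∪ {x | ∃ y ∈ Y₂, dist x y ≤ r} ⊆ Y'

namespace BigFamily

/-- The big family `{Y}` of all subsets of uniform thickenings of `Y`. -/
def ofSet (Y : Set X) : BigFamily X where
  sets := {Z | ∃ r > 0, Z ⊆ {x | ∃ y ∈ Y, dist x y ≤ r}}
  nonempty := ⟨∅, 1, one_pos, Set.empty_subset _⟩
  exists_union := by
    rintro Y₁ ⟨r₁, hr₁, h₁⟩ Y₂ ⟨r₂, hr₂, h₂⟩ r hr
    refine ⟨{x | ∃ y ∈ Y, dist x y ≤ r + (r₁ + r₂)}, ⟨_, by positivity, subset_rfl⟩, ?_⟩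
    rintro x (⟨y, hy, hxy⟩ | ⟨y, hy, hxy⟩)
    · obtain ⟨z, hz, hyz⟩ := h₁ hy
      exact ⟨z, hz, (dist_triangle x y z).trans (by linarith)⟩
    · obtain ⟨z, hz, hyz⟩ := h₂ hy
      exact ⟨z, hz, (dist_triangle x y z).trans (by linarith)⟩

/-- The intersection `𝒴 ∩ 𝒴' = {Y ∩ Y' | Y ∈ 𝒴, Y' ∈ 𝒴'}` of two big families. -/
def inter (𝒴 𝒵 : BigFamily X) : BigFamily X where
  sets := {W | ∃ Y ∈ 𝒴.sets, ∃ Z ∈ 𝒵.sets, W = Y ∩ Z}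
  nonempty := by
    obtain ⟨Y, hY⟩ := 𝒴.nonempty
    obtain ⟨Z, hZ⟩ := 𝒵.nonempty
    exact ⟨Y ∩ Z, Y, hY, Z, hZ, rfl⟩
  exists_union := by
    rintro _ ⟨Y₁, hY₁, Z₁, hZ₁, rfl⟩ _ ⟨Y₂, hY₂, Z₂, hZ₂, rfl⟩ r hr
    obtain ⟨Y', hY', hY⟩ := 𝒴.exists_union Y₁ hY₁ Y₂ hY₂ r hr
    obtain ⟨Z', hZ', hZ⟩ := 𝒵.exists_union Z₁ hZ₁ Z₂ hZ₂ r hr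
    refine ⟨_, ⟨Y', hY', Z', hZ', rfl⟩, ?_⟩
    rintro x (⟨y, hy, hxy⟩ | ⟨y, hy, hxy⟩)
    · exact ⟨hY (.inl ⟨y, hy.1, hxy⟩), hZ (.inl ⟨y, hy.2, hxy⟩)⟩
    · exact ⟨hY (.inr ⟨y, hy.1, hxy⟩), hZ (.inr ⟨y, hy.2, hxy⟩)⟩

/-- The coarse boundary `∂Y = {Y} ∩ {X ∖ Y}`. -/
def coarseBoundary (Y : Set X) : BigFamily X := (ofSet Y).inter (ofSet Yᶜ)

end BigFamily

namespace XModule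

variable (M : XModule X ℋ)

/-- `T` is supported in `Z`: `f T = T f = 0` for all `f ∈ C₀(X)` with support in `X ∖ Z`. -/
def SupportedIn (T : ℋ →L[ℂ] ℋ) (Z : Set X) : Prop :=
  ∀ f : C₀(X, ℂ), tsupport f ⊆ Zᶜ → M.rep f * T = 0 ∧ T * M.rep f = 0

variable {M} in
theorem SupportedIn.mono {T : ℋ →L[ℂ] ℋ} {Z Z' : Set X} (h : M.SupportedIn T Z) (hZ : Z ⊆ Z') :
    M.SupportedIn T Z' :=
  fun f hf => h f (hf.trans (Set.compl_subset_compl.2 hZ))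

theorem subset_of_exists_union {Y : Set X} {r : ℝ} (hr : 0 < r) :
    Y ⊆ {x | ∃ y ∈ Y, dist x y ≤ r} :=
  fun x hx => ⟨x, hx, by rw [dist_self]; exact hr.le⟩

/-- The star algebra of the elements of the Roe algebra supported in the big family `𝒴`. -/
def localizedCore (𝒴 : BigFamily X) : NonUnitalStarSubalgebra ℂ (ℋ →L[ℂ] ℋ) where
  carrier := {T | T ∈ M.roeAlgebra ∧ ∃ Z ∈ 𝒴.sets, M.SupportedIn T Z}
  zero_mem' := by
    obtain ⟨Z, hZ⟩ := 𝒴.nonempty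
    exact ⟨zero_mem _, Z, hZ, fun f _ => by simp⟩
  add_mem' := by
    rintro S T ⟨hS, Y, hY, hSY⟩ ⟨hT, Z, hZ, hTZ⟩
    obtain ⟨W, hW, h⟩ := 𝒴.exists_union Y hY Z hZ 1 one_pos
    rw [Set.union_subset_iff] at h
    refine ⟨add_mem hS hT, W, hW, fun f hf => ?_⟩
    have h1 := hSY.mono ((subset_of_exists_union one_pos).trans h.1) f hf
    have h2 := hTZ.mono ((subset_of_exists_union one_pos).trans h.2) f hf
    rw [mul_add, add_mul, h1.1, h1.2, h2.1, h2.2, add_zero]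
    exact ⟨rfl, rfl⟩
  smul_mem' := by
    rintro c T ⟨hT, Z, hZ, hTZ⟩
    refine ⟨SMulMemClass.smul_mem c hT, Z, hZ, fun f hf => ?_⟩
    rw [mul_smul_comm, smul_mul_assoc, (hTZ f hf).1, (hTZ f hf).2, smul_zero]
    exact ⟨rfl, rfl⟩
  mul_mem' := by
    rintro S T ⟨hS, Y, hY, hSY⟩ ⟨hT, Z, hZ, hTZ⟩
    obtain ⟨W, hW, h⟩ := 𝒴.exists_union Y hY Z hZ 1 one_pos
    rw [Set.union_subset_iff] at h
    refine ⟨mul_mem hS hT, W, hW, fun f hf => ?_⟩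
    have h1 := hSY.mono ((subset_of_exists_union one_pos).trans h.1) f hf
    have h2 := hTZ.mono ((subset_of_exists_union one_pos).trans h.2) f hf
    rw [← mul_assoc, h1.1, mul_assoc, h2.2, zero_mul, mul_zero]
    exact ⟨rfl, rfl⟩
  star_mem' := by
    rintro T ⟨hT, Z, hZ, hTZ⟩
    refine ⟨star_mem hT, Z, hZ, fun f hf => ?_⟩
    have hf' : tsupport (star f : C₀(X, ℂ)) ⊆ Zᶜ := by
      refine subset_trans (closure_mono fun x hx => ?_) hf
      simpa using hx
    have h1 := congrArg star (hTZ _ hf').1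
    have h2 := congrArg star (hTZ _ hf').2
    rw [StarMul.star_mul (R := ℋ →L[ℂ] ℋ), ← map_star, star_star, star_zero] at h1 h2
    exact ⟨h2, h1⟩

/-- The localized Roe algebra `C*_Roe(𝒴)`. -/
def localizedRoe (𝒴 : BigFamily X) : NonUnitalStarSubalgebra ℂ (ℋ →L[ℂ] ℋ) :=
  (M.localizedCore 𝒴).topologicalClosure

instance (𝒴 : BigFamily X) : IsClosed (M.localizedRoe 𝒴 : Set (ℋ →L[ℂ] ℋ)) :=
  NonUnitalStarSubalgebra.isClosed_topologicalClosure _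

theorem localizedRoe_le (𝒴 : BigFamily X) : M.localizedRoe 𝒴 ≤ M.roeAlgebra :=
  NonUnitalStarSubalgebra.topologicalClosure_minimal _ (fun _ hT => hT.1)
    (NonUnitalStarSubalgebra.isClosed_topologicalClosure _)

section MayerVietoris

variable {M}

theorem SupportedIn.openProj_mul {T : ℋ →L[ℂ] ℋ} {Z : Set X} (h : M.SupportedIn T Z) {ε : ℝ}
    (hε : 0 < ε) : M.openProj (Metric.thickening ε Z) * T = T := by
  refine M.openProj_mul_eq_self Metric.isOpen_thickening
    (V := (Metric.cthickening (ε / 2) Z)ᶜ) Metric.isClosed_cthickening.isOpen_compl ?_ ?_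
  · rw [Set.eq_univ_iff_forall]
    intro x
    by_cases hx : x ∈ Metric.cthickening (ε / 2) Z
    · exact .inl (Metric.cthickening_subset_thickening' hε (by linarith) Z hx)
    · exact .inr hx
  · refine M.openProj_mul_eq_zero fun f hf => (h f ?_).1
    have h1 : tsupport f ⊆ (Metric.thickening (ε / 2) Z)ᶜ := by
      refine closure_minimal (fun x hx hx' => hx (hf x fun hx'' => hx'' ?_))
        Metric.isOpen_thickening.isClosed_compl
      exact Metric.thickening_subset_cthickening _ _ hx'
    exact h1.trans (Set.compl_subset_compl.2 (Metric.self_subset_thickening (by linarith) Z))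

theorem SupportedIn.star {T : ℋ →L[ℂ] ℋ} {Z : Set X} (hTZ : M.SupportedIn T Z) :
    M.SupportedIn (star T) Z := by
  intro f hf
  have hf' : tsupport (Star.star f : C₀(X, ℂ)) ⊆ Zᶜ := by
    refine subset_trans (closure_mono fun x hx => ?_) hf
    simpa using hx
  have h1 := congrArg Star.star (hTZ _ hf').1
  have h2 := congrArg Star.star (hTZ _ hf').2
  rw [StarMul.star_mul (R := ℋ →L[ℂ] ℋ), ← map_star, star_star, star_zero] at h1 h2
  exact ⟨h2, h1⟩

theorem SupportedIn.mul_openProj {T : ℋ →L[ℂ] ℋ} {Z : Set X} (h : M.SupportedIn T Z) {ε : ℝ}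
    (hε : 0 < ε) : T * M.openProj (Metric.thickening ε Z) = T := by
  have := congrArg Star.star (h.star.openProj_mul hε)
  rwa [StarMul.star_mul (R := ℋ →L[ℂ] ℋ), star_openProj, star_star] at this

variable (M)

theorem supportedIn_of_openProj {T : ℋ →L[ℂ] ℋ} {U : Set X} (h1 : M.openProj U * T = T)
    (h2 : T * M.openProj U = T) : M.SupportedIn T U := by
  intro f hf
  have hf' : ∀ x ∈ U, f x = 0 := fun x hx => image_eq_zero_of_notMem_tsupport fun h => hf h hx
  have e1 := M.rep_mul_openProj_eq_zero hf'
  have e2 := e1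
  rw [← M.openProj_comm_rep] at e2
  exact ⟨by rw [← h1, ← mul_assoc, e1, zero_mul], by rw [← h2, mul_assoc, e2, mul_zero]⟩

theorem thickening_mem_ofSet {s : ℝ} (hs : 0 < s) (Y : Set X) :
    Metric.thickening s Y ∈ (BigFamily.ofSet Y).sets := by
  refine ⟨s, hs, fun x hx => ?_⟩
  obtain ⟨y, hy, hxy⟩ := Metric.mem_thickening_iff.1 hx
  exact ⟨y, hy, hxy.le⟩

theorem exists_openProj_of_mem {Y : Set X} {T : ℋ →L[ℂ] ℋ}
    (hT : T ∈ M.localizedCore (.ofSet Y)) : ∃ s > 0,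
      M.openProj (Metric.thickening s Y) * T = T ∧ T * M.openProj (Metric.thickening s Y) = T := by
  obtain ⟨-, Z, ⟨r, hr, hZ⟩, hTZ⟩ := hT
  have hsub : Metric.thickening 1 Z ⊆ Metric.thickening (r + 1) Y := by
    intro x hx
    obtain ⟨z, hz, hxz⟩ := Metric.mem_thickening_iff.1 hx
    obtain ⟨y, hy, hzy⟩ := hZ hz
    exact Metric.mem_thickening_iff.2 ⟨y, hy, (dist_triangle x z y).trans_lt (by linarith)⟩
  refine ⟨r + 1, by linarith, ?_, ?_⟩
  · rw [← hTZ.openProj_mul one_pos, ← mul_assoc, M.openProj_mul_of_subset hsub]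
  · rw [← hTZ.mul_openProj one_pos, mul_assoc, M.openProj_mul_of_subset' hsub]

theorem mem_core_of_openProj {Y : Set X} {T : ℋ →L[ℂ] ℋ} (hT : T ∈ M.roeAlgebra) {s : ℝ}
    (hs : 0 < s) (h1 : M.openProj (Metric.thickening s Y) * T = T)
    (h2 : T * M.openProj (Metric.thickening s Y) = T) : T ∈ M.localizedCore (.ofSet Y) :=
  ⟨hT, _, thickening_mem_ofSet hs Y, M.supportedIn_of_openProj h1 h2⟩

/-- `T D` is localized near `Y` if `D` is. -/
theorem mul_mem_localizedRoe_of {Y : Set X} {T D : ℋ →L[ℂ] ℋ} (hT : T ∈ M.roeAlgebra) {s : ℝ}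
    (hs : 0 < s) (h1 : M.openProj (Metric.thickening s Y) * D = D)
    (h2 : D * M.openProj (Metric.thickening s Y) = D)
    (hD : ∀ S ∈ M.roeAlgebra, S * D ∈ M.roeAlgebra) : T * D ∈ M.localizedRoe (.ofSet Y) := by
  refine mem_closure_of_mul_right hT fun S hS => ?_
  obtain ⟨r, hr, hS'⟩ := hS.2.exists_propLE
  have hsub : Metric.thickening s Y ⊆ Metric.thickening (s + r + 1) Y :=
    Metric.thickening_mono (by linarith) Y
  refine M.mem_core_of_openProj (s := s + r + 1)
    (hD S (NonUnitalStarSubalgebra.le_topologicalClosure _ hS)) (by linarith) ?_ ?_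
  · rw [← h1, ← mul_assoc S, ← mul_assoc, hS'.push hr hs]
  · rw [← h2, ← mul_assoc S, mul_assoc, M.openProj_mul_of_subset' hsub]

theorem mul_mem_localizedRoe {Y : Set X} {T D : ℋ →L[ℂ] ℋ} (hT : T ∈ M.roeAlgebra)
    (hD : D ∈ M.localizedRoe (.ofSet Y)) : T * D ∈ M.localizedRoe (.ofSet Y) := by
  have hcl : T * D ∈ closure (M.localizedRoe (.ofSet Y) : Set (ℋ →L[ℂ] ℋ)) := by
    refine map_mem_closure (f := fun S => T * S) (continuous_const.mul continuous_id) hD ?_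
    intro S hS
    obtain ⟨s, hs, h1, h2⟩ := M.exists_openProj_of_mem hS
    exact M.mul_mem_localizedRoe_of hT hs h1 h2 fun R hR => mul_mem hR hS.1
  exact (inferInstance : IsClosed (M.localizedRoe (.ofSet Y) : Set (ℋ →L[ℂ] ℋ))).closure_subset
    hcl

theorem norm_openProj_le (U : Set X) : ‖M.openProj U‖ ≤ 1 :=
  Submodule.starProjection_norm_le _

theorem norm_openProj_mul_mul_le (U : Set X) (T : ℋ →L[ℂ] ℋ) :
    ‖M.openProj U * T * M.openProj U‖ ≤ ‖T‖ := by
  have h1 := norm_mul_le (M.openProj U * T) (M.openProj U)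
  have h2 := norm_mul_le (M.openProj U) T
  have h3 := M.norm_openProj_le U
  nlinarith [norm_nonneg T, norm_nonneg (M.openProj U), norm_nonneg (M.openProj U * T)]

theorem exists_norm_sub_lt {Y : Set X} {T : ℋ →L[ℂ] ℋ} (hT : T ∈ M.localizedRoe (.ofSet Y))
    {ε : ℝ} (hε : 0 < ε) : ∃ s > 0, ‖T - M.openProj (Metric.thickening s Y) * T *
      M.openProj (Metric.thickening s Y)‖ < ε := by
  obtain ⟨S, hS, hTS⟩ := Metric.mem_closure_iff.1 hT (ε / 2) (by linarith)
  obtain ⟨s, hs, h1, h2⟩ := M.exists_openProj_of_mem hS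
  refine ⟨s, hs, ?_⟩
  set P := M.openProj (Metric.thickening s Y)
  have e : T - P * T * P = (T - S) - P * (T - S) * P := by
    rw [mul_sub, sub_mul, h1, h2]; abel
  rw [dist_eq_norm] at hTS
  rw [e]
  have h3 := norm_sub_le (T - S) (P * (T - S) * P)
  have h4 := M.norm_openProj_mul_mul_le (Metric.thickening s Y) (T - S)
  change ‖P * (T - S) * P‖ ≤ _ at h4
  linarith

theorem localizedRoe_mono {𝒴 𝒵 : BigFamily X} (h : ∀ Y ∈ 𝒴.sets, ∃ Z ∈ 𝒵.sets, Y ⊆ Z) :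
    M.localizedRoe 𝒴 ≤ M.localizedRoe 𝒵 := by
  refine NonUnitalStarSubalgebra.topologicalClosure_mono ?_
  rintro T ⟨hT, Y, hY, hTY⟩
  obtain ⟨Z, hZ, hYZ⟩ := h Y hY
  exact ⟨hT, Z, hZ, hTY.mono hYZ⟩

theorem mem_localizedRoe_coarseBoundary {Y : Set X} {T : ℋ →L[ℂ] ℋ} :
    T ∈ M.localizedRoe (.coarseBoundary Y) ↔
      T ∈ M.localizedRoe (.ofSet Y) ∧ T ∈ M.localizedRoe (.ofSet Yᶜ) := by
  constructor
  · refine fun hT => ⟨M.localizedRoe_mono ?_ hT, M.localizedRoe_mono ?_ hT⟩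
    · rintro _ ⟨Z, hZ, Z', hZ', rfl⟩
      exact ⟨Z, hZ, Set.inter_subset_left⟩
    · rintro _ ⟨Z, hZ, Z', hZ', rfl⟩
      exact ⟨Z', hZ', Set.inter_subset_right⟩
  · rintro ⟨h1, h2⟩
    refine Metric.mem_closure_iff.2 fun ε hε => ?_
    obtain ⟨s, hs, hs'⟩ := M.exists_norm_sub_lt h1 (half_pos hε)
    obtain ⟨t, ht, ht'⟩ := M.exists_norm_sub_lt h2 (half_pos hε)
    set U := Metric.thickening s Y with hU
    set U' := Metric.thickening t Yᶜ with hU'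
    have hTr : T ∈ M.roeAlgebra := M.localizedRoe_le _ h1
    refine ⟨M.openProj (U ∩ U') * T * M.openProj (U ∩ U'), ⟨?_, U ∩ U', ?_, ?_⟩, ?_⟩
    · exact M.mul_openProj_mem_roe (M.openProj_mul_mem_roe hTr _) _
    · exact ⟨U, thickening_mem_ofSet hs Y, U', thickening_mem_ofSet ht Yᶜ, rfl⟩
    · refine M.supportedIn_of_openProj ?_ ?_
      · rw [← mul_assoc, ← mul_assoc, M.openProj_mul_self]
      · rw [mul_assoc, M.openProj_mul_self]
    · rw [dist_eq_norm]
      have e : T - M.openProj (U ∩ U') * T * M.openProj (U ∩ U') =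
          (T - M.openProj U * T * M.openProj U) +
            M.openProj U * (T - M.openProj U' * T * M.openProj U') * M.openProj U := by
        have e1 := M.openProj_mul_openProj U U'
        have e2 := e1
        rw [M.openProj_comm] at e2
        nth_rewrite 1 [← e1]
        rw [← e2]
        simp only [mul_sub, sub_mul, mul_assoc]
        abel
      rw [e]
      have h3 := norm_add_le (T - M.openProj U * T * M.openProj U)
        (M.openProj U * (T - M.openProj U' * T * M.openProj U') * M.openProj U)
      have h4 := M.norm_openProj_mul_mul_le U (T - M.openProj U' * T * M.openProj U')
      linarith

theorem mul_openProj_mem_localizedRoe {T : ℋ →L[ℂ] ℋ} (hT : T ∈ M.roeAlgebra) (Y : Set X) :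
    T * M.openProj (Metric.thickening 1 Y) ∈ M.localizedRoe (.ofSet Y) :=
  M.mul_mem_localizedRoe_of hT one_pos (M.openProj_mul_self _) (M.openProj_mul_self _)
    fun _ hS => M.mul_openProj_mem_roe hS _

theorem mul_one_sub_mem_localizedRoe {T : ℋ →L[ℂ] ℋ} (hT : T ∈ M.roeAlgebra) (Y : Set X) :
    T * (1 - M.openProj (Metric.thickening 1 Y)) ∈ M.localizedRoe (.ofSet Yᶜ) := by
  have hcover : Metric.thickening 1 Yᶜ ∪ Metric.thickening 1 Y = Set.univ := by
    rw [Set.eq_univ_iff_forall]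
    intro x
    by_cases hx : x ∈ Y
    · exact .inr (Metric.self_subset_thickening one_pos _ hx)
    · exact .inl (Metric.self_subset_thickening one_pos _ hx)
  have h1 := M.one_sub_mul_one_sub Metric.isOpen_thickening Metric.isOpen_thickening hcover
  rw [sub_mul, one_mul, sub_eq_zero] at h1
  refine M.mul_mem_localizedRoe_of hT one_pos h1.symm ?_ ?_
  · have h2 := congrArg star h1
    rw [StarMul.star_mul (R := ℋ →L[ℂ] ℋ), star_sub, star_one, star_openProj,
      star_openProj] at h2
    exact h2.symm
  · intro S hS
    rw [mul_sub, mul_one]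
    exact sub_mem hS (M.mul_openProj_mem_roe hS _)

/-- The Roe algebra of `X` is decomposed by the ideals `C*_Roe({Y})` and `C*_Roe({X ∖ Y})`, whose
intersection is `C*_Roe(∂Y)`. -/
theorem isMayerVietoris (Y : Set X) :
    KTheory.IsMayerVietoris M.roeAlgebra (M.localizedRoe (.ofSet Y)) (M.localizedRoe (.ofSet Yᶜ))
      (M.localizedRoe (.coarseBoundary Y)) where
  left_le := M.localizedRoe_le _
  isClosed_left := inferInstance
  isClosed_right := inferInstance
  mul_mem_left _ ha _ hx := M.mul_mem_localizedRoe ha hx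
  mul_mem_right _ ha _ hx := M.mul_mem_localizedRoe ha hx
  mem_inter _ := M.mem_localizedRoe_coarseBoundary
  exists_split := by
    set P := M.openProj (Metric.thickening 1 Y) with hP
    have hPs : star P = P := M.star_openProj _
    let L : (ℋ →L[ℂ] ℋ) →L[ℂ] (ℋ →L[ℂ] ℋ) := (1 / 2 : ℂ) •
      (ContinuousLinearMap.mul ℂ (ℋ →L[ℂ] ℋ) P +
        (ContinuousLinearMap.mul ℂ (ℋ →L[ℂ] ℋ)).flip P)
    have hL : ∀ T, L T = (1 / 2 : ℂ) • (P * T + T * P) := fun T => rfl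
    refine ⟨L, fun T => ?_, fun T hT => ⟨?_, ?_⟩⟩
    · rw [hL, hL, star_smul, star_add, StarMul.star_mul (R := ℋ →L[ℂ] ℋ),
        StarMul.star_mul (R := ℋ →L[ℂ] ℋ), hPs, add_comm]
      congr 1
      simp
    · rw [hL]
      refine SMulMemClass.smul_mem _ (add_mem ?_ (M.mul_openProj_mem_localizedRoe hT Y))
      have := star_mem (M.mul_openProj_mem_localizedRoe (star_mem hT) Y)
      rwa [StarMul.star_mul (R := ℋ →L[ℂ] ℋ), star_star, ← hP, hPs] at this
    · have h1 := M.mul_one_sub_mem_localizedRoe hT Y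
      have h2 := star_mem (M.mul_one_sub_mem_localizedRoe (star_mem hT) Y)
      rw [StarMul.star_mul (R := ℋ →L[ℂ] ℋ), star_star, star_sub, star_one, ← hP, hPs] at h2
      have e : T - L T = (1 / 2 : ℂ) • ((1 - P) * T + T * (1 - P)) := by
        rw [hL, sub_mul, mul_sub, one_mul, mul_one]
        module
      rw [e]
      exact SMulMemClass.smul_mem _ (add_mem h2 h1)

/-- The coarse Mayer–Vietoris boundary map `∂ : K₀(C*_Roe(X)) → K₁(C*_Roe(∂Y))`. -/
def coarseBoundaryMap (Y : Set X) :
    KTheory.K0 M.roeAlgebra →+ KTheory.K1 (M.localizedRoe (.coarseBoundary Y)) :=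
  (M.isMayerVietoris Y).boundary

end MayerVietoris

end XModule

section hamiltonian

open Complex
open scoped ComplexOrder

/-- The bounded operator `R` is the inverse of `T - z`, for `T` a possibly unbounded operator. -/
def IsResolventAt (T : ℋ →ₗ.[ℂ] ℋ) (z : ℂ) (R : ℋ →L[ℂ] ℋ) : Prop :=
  (∀ v, ∃ h : R v ∈ T.domain, T ⟨R v, h⟩ - z • R v = v) ∧
    ∀ x : T.domain, R (T x - z • (x : ℋ)) = x

/-- The spectrum of a possibly unbounded operator. -/
def spec (T : ℋ →ₗ.[ℂ] ℋ) : Set ℂ := {z | ¬ ∃ R : ℋ →L[ℂ] ℋ, IsResolventAt T z R}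

open Classical in
/-- The resolvent `(T - z)⁻¹` (defined to be `0` if `z` is in the spectrum of `T`). -/
def resolvent (T : ℋ →ₗ.[ℂ] ℋ) (z : ℂ) : ℋ →L[ℂ] ℋ :=
  if h : ∃ R : ℋ →L[ℂ] ℋ, IsResolventAt T z R then h.choose else 0

/-- The functional calculus `f(H)` of a self-adjoint operator `H`. In terms of the bounded normal
operator `R = (H + i)⁻¹`, whose spectrum consists of the numbers `z = (t + i)⁻¹`, `t` in the
spectrum of `H` (and of `z = 0`, corresponding to `t = ∞`, if `H` is unbounded), it is `g(R)`, where
`g(z) = f(z⁻¹ - i)` and `g(0) = 0`. -/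
def fc (H : ℋ →ₗ.[ℂ] ℋ) (f : ℝ → ℂ) : ℋ →L[ℂ] ℋ :=
  cfc (fun z : ℂ => if z = 0 then 0 else f (z⁻¹ - I).re) (resolvent H (-I))

/-- The Fermi projection `p_E`, the spectral projection of `H` to the energies below `E`. -/
def fermiProjection (H : ℋ →ₗ.[ℂ] ℋ) (E : ℝ) : ℋ →L[ℂ] ℋ :=
  fc H ((Set.Iio E).indicator fun _ => 1)

/-- `H` is insulating at the energy `E` if `E` is not in its spectrum. -/
def IsInsulating (H : ℋ →ₗ.[ℂ] ℋ) (E : ℝ) : Prop := (E : ℂ) ∉ spec H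

/-- `H` is a Hamiltonian compatible with the Roe algebra: a positive self-adjoint operator such
that `f(H)` is in the Roe algebra for all `f ∈ C_c(ℝ)`. -/
structure IsCompatibleHamiltonian (M : XModule X ℋ) (H : ℋ →ₗ.[ℂ] ℋ) : Prop where
  isSelfAdjoint : IsSelfAdjoint H
  nonneg : ∀ x : H.domain, 0 ≤ (inner ℂ (x : ℋ) (H x)).re
  fc_mem : ∀ f : CompactlySupportedContinuousMap ℝ ℂ, fc H f ∈ M.roeAlgebra

/-- `Htilde` is a Hamiltonian on `Y` adapted to `H`: a self-adjoint operator, bounded from below,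
with `f(Htilde) ∈ C*_Roe({Y})` and `f(H) - f(Htilde) ∈ C*_Roe({X ∖ Y})` for all `f ∈ C₀(ℝ)`.
The operator acts on a Hilbert space `𝒦` embedded isometrically in `ℋ` (such as `ℋ` itself, or
`L²(Y)` inside `L²(X)`), and `f(Htilde)` is extended by zero to `ℋ`. -/
structure IsAdaptedHamiltonian (M : XModule X ℋ) (H : ℋ →ₗ.[ℂ] ℋ) (Y : Set X)
    {𝒦 : Type*} [NormedAddCommGroup 𝒦] [InnerProductSpace ℂ 𝒦] [CompleteSpace 𝒦]
    (j : 𝒦 →ₗᵢ[ℂ] ℋ) (Htilde : 𝒦 →ₗ.[ℂ] 𝒦) : Prop where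
  isSelfAdjoint : IsSelfAdjoint Htilde
  bddBelow : ∃ c : ℝ, ∀ x : Htilde.domain,
    c * ‖(x : 𝒦)‖ ^ 2 ≤ (inner ℂ (x : 𝒦) (Htilde x)).re
  fc_mem : ∀ f : C₀(ℝ, ℂ),
    j.toContinuousLinearMap ∘L fc Htilde f ∘L j.toContinuousLinearMap.adjoint ∈
      M.localizedRoe (.ofSet Y)
  sub_mem : ∀ f : C₀(ℝ, ℂ),
    fc H f - j.toContinuousLinearMap ∘L fc Htilde f ∘L j.toContinuousLinearMap.adjoint ∈
      M.localizedRoe (.ofSet Yᶜ)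

theorem isStarProjection_cfc {g : ℂ → ℂ} (hg : ∀ z, g z = 0 ∨ g z = 1) (R : ℋ →L[ℂ] ℋ) :
    IsStarProjection (cfc g R) := by
  by_cases hR : IsStarNormal R
  · by_cases hc : ContinuousOn g (spectrum ℂ R)
    · constructor
      · rw [IsIdempotentElem, ← cfc_mul g g R]
        congr 1
        ext z
        rcases hg z with h | h <;> simp [h]
      · rw [IsSelfAdjoint, ← cfc_star]
        congr 1
        ext z
        rcases hg z with h | h <;> simp [h]
    · rw [cfc_apply_of_not_continuousOn R hc]
      exact .zero _
  · rw [cfc_apply_of_not_predicate R hR]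
    exact .zero _

theorem isStarProjection_fermiProjection (H : ℋ →ₗ.[ℂ] ℋ) (E : ℝ) :
    IsStarProjection (fermiProjection H E) := by
  refine isStarProjection_cfc (fun z => ?_) _
  by_cases hz : z = 0
  · simp [hz]
  · by_cases h : (z⁻¹ - I).re ∈ Set.Iio E
    · right; rw [if_neg hz, Set.indicator_of_mem h]
    · left; rw [if_neg hz, Set.indicator_of_notMem h]

theorem notMem_spectrum_of_isResolventAt {H : ℋ →ₗ.[ℂ] ℋ} {R S : ℋ →L[ℂ] ℋ} {a b : ℂ}
    (hR : IsResolventAt H a R) (hS : IsResolventAt H b S) (hab : b - a ≠ 0) :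
    (b - a)⁻¹ ∉ spectrum ℂ R := by
  have hRS : ∀ v, R (v + (b - a) • S v) = S v := by
    intro v
    obtain ⟨h, e⟩ := hS.1 v
    refine Eq.trans (congrArg R ?_) (hR.2 ⟨S v, h⟩)
    change _ = H ⟨S v, h⟩ - a • S v
    nth_rewrite 1 [← e]
    module
  have hSR : ∀ v, S (v - (b - a) • R v) = R v := by
    intro v
    obtain ⟨h, e⟩ := hR.1 v
    refine Eq.trans (congrArg S ?_) (hS.2 ⟨R v, h⟩)
    change _ = H ⟨R v, h⟩ - b • R v
    nth_rewrite 1 [← e]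
    module
  rw [spectrum.notMem_iff]
  have e : algebraMap ℂ (ℋ →L[ℂ] ℋ) (b - a)⁻¹ - R = (b - a)⁻¹ • (1 - (b - a) • R) := by
    rw [smul_sub, smul_smul, inv_mul_cancel₀ hab, one_smul, Algebra.algebraMap_eq_smul_one]
  have hu : IsUnit (1 - (b - a) • R) := by
    refine ⟨⟨1 - (b - a) • R, 1 + (b - a) • S, ?_, ?_⟩, rfl⟩
    · ext v
      have := hRS v
      simp only [mul_apply_eq_comp, sub_apply, add_apply,
        smul_apply, one_apply_eq_self, this]
      abel
    · ext v
      have := hSR v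
      simp only [mul_apply_eq_comp, sub_apply, add_apply,
        smul_apply, one_apply_eq_self, this]
      abel
  rw [e]
  exact hu.smul (Units.mk0 (b - a)⁻¹ (inv_ne_zero hab))

theorem inner_comm_of_isSelfAdjoint {H : ℋ →ₗ.[ℂ] ℋ} (hH : IsSelfAdjoint H) (x : H.domain) :
    inner ℂ (H x) (x : ℋ) = inner ℂ (x : ℋ) (H x) := by
  have := LinearPMap.adjoint_isFormalAdjoint hH.dense_domain
  rw [LinearPMap.isSelfAdjoint_def.1 hH] at this
  exact this x x

/-- The spectrum of `(H + i)⁻¹` lies in the curve of all `(t + i)⁻¹`, `t ≥ 0`, if `H ≥ 0`. -/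
theorem mem_spectrum_resolvent {H : ℋ →ₗ.[ℂ] ℋ} (hH : IsSelfAdjoint H)
    (hpos : ∀ x : H.domain, 0 ≤ (inner ℂ (x : ℋ) (H x)).re) {R : ℋ →L[ℂ] ℋ}
    (hR : IsResolventAt H (-I) R) (hn : IsStarNormal R) {z : ℂ} (hz : z ∈ spectrum ℂ R)
    (hz0 : z ≠ 0) : 0 ≤ (z⁻¹ - I).re ∧ z⁻¹ = (((z⁻¹ - I).re : ℝ) : ℂ) + I := by
  have key : ∀ v, (inner ℂ (R v) v).im = ‖R v‖ ^ 2 ∧ 0 ≤ (inner ℂ (R v) v).re := by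
    intro v
    obtain ⟨h, e⟩ := hR.1 v
    have him : (inner ℂ (R v) (H ⟨R v, h⟩)).im = 0 := by
      have := inner_comm_of_isSelfAdjoint hH ⟨R v, h⟩
      have h2 := inner_conj_symm (𝕜 := ℂ) (R v) (H ⟨R v, h⟩)
      change inner ℂ (H ⟨R v, h⟩) (R v) = inner ℂ (R v) (H ⟨R v, h⟩) at this
      rw [this] at h2
      exact Complex.conj_eq_iff_im.1 h2
    have hre := hpos ⟨R v, h⟩
    change 0 ≤ (inner ℂ (R v) (H ⟨R v, h⟩)).re at hre
    have e2 : inner ℂ (R v) v = inner ℂ (R v) (H ⟨R v, h⟩) + I * ((‖R v‖ ^ 2 : ℝ) : ℂ) := by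
      nth_rewrite 2 [← e]
      rw [inner_sub_right, inner_smul_right, inner_self_eq_norm_sq_to_K]
      push_cast
      simp
    rw [e2]
    constructor
    · rw [add_im, him, I_mul_im, ofReal_re, zero_add]
    · rw [add_re, I_mul_re, ofReal_im, neg_zero, add_zero]; exact hre
  have h1 : R - star R = (-2 * I) • (star R * R) := by
    refine ContinuousLinearMap.coe_injective ((ext_inner_map _ _).1 fun v => ?_)
    change inner ℂ ((R - star R) v) v = inner ℂ (((-2 * I) • (star R * R)) v) v
    rw [sub_apply, smul_apply, mul_apply_eq_comp,
      ContinuousLinearMap.star_eq_adjoint, inner_sub_left, inner_smul_left,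
      ContinuousLinearMap.adjoint_inner_left, ContinuousLinearMap.adjoint_inner_left,
      inner_self_eq_norm_sq_to_K]
    have := (key v).1
    have hs : inner ℂ v (R v) = star (inner ℂ (R v) v) := (inner_conj_symm v (R v)).symm
    rw [hs]
    generalize inner ℂ (R v) v = c at this
    apply Complex.ext
    · simp [← ofReal_pow]
    · simp [← ofReal_pow, this]; ring
  have h2 : 0 ≤ R + star R := by
    rw [ContinuousLinearMap.nonneg_iff_isPositive]
    refine (ContinuousLinearMap.isPositive_iff_complex _).2 fun v => ?_
    have e : inner ℂ ((R + star R) v) v = ((2 * (inner ℂ (R v) v).re : ℝ) : ℂ) := by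
      rw [add_apply, ContinuousLinearMap.star_eq_adjoint, inner_add_left,
        ContinuousLinearMap.adjoint_inner_left, ← inner_conj_symm v (R v), Complex.add_conj]
    rw [e]
    have := (key v).2
    exact ⟨by simp, by simpa using this⟩
  have hid : cfc (fun w : ℂ => w) R = R := cfc_id' ℂ R
  have hst : cfc (fun w : ℂ => star w) R = star R := cfc_star_id R
  have e1 : cfc (fun w : ℂ => w - star w) R = cfc (fun w : ℂ => (-2 * I) * (star w * w)) R := by
    rw [cfc_sub (fun w : ℂ => w) (fun w => star w) R, hid, hst,
      cfc_const_mul (-2 * I) (fun w : ℂ => star w * w) R,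
      cfc_mul (fun w : ℂ => star w) (fun w => w) R, hid, hst, h1]
  have e2 : 0 ≤ cfc (fun w : ℂ => w + star w) R := by
    rw [cfc_add R (fun w : ℂ => w) (fun w => star w), hid, hst]
    exact h2
  have f1 : z - star z = (-2 * I) * (star z * z) :=
    (by exact eqOn_of_cfc_eq_cfc e1 : Set.EqOn (fun w : ℂ => w - star w)
      (fun w : ℂ => (-2 * I) * (star w * w)) (spectrum ℂ R)) hz
  have f2 : 0 ≤ z + star z := (cfc_nonneg_iff (fun w : ℂ => w + star w) R).1 e2 z hz
  have g1 : z.im = -normSq z := by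
    have := congrArg Complex.im f1
    rw [Complex.star_def, ← normSq_eq_conj_mul_self] at this
    simp at this
    linarith
  have g2 : 0 ≤ z.re := by
    have := (Complex.le_def.1 f2).1
    simp at this
    linarith
  have hns : 0 < normSq z := normSq_pos.2 hz0
  constructor
  · rw [sub_re, I_re, sub_zero, inv_re]
    positivity
  · apply Complex.ext
    · simp
    · rw [inv_im, g1]
      simp [hns.ne']

/-- The Fermi projection of a Hamiltonian in a spectral gap lies in the Roe algebra. -/
theorem IsCompatibleHamiltonian.fermiProjection_mem {M : XModule X ℋ} {H : ℋ →ₗ.[ℂ] ℋ}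
    (hH : IsCompatibleHamiltonian M H) {E : ℝ} (hE : IsInsulating H E) :
    fermiProjection H E ∈ M.roeAlgebra := by
  by_cases hex : ∃ R : ℋ →L[ℂ] ℋ, IsResolventAt H (-I) R
  · by_cases hn : IsStarNormal (resolvent H (-I))
    · have hR : IsResolventAt H (-I) (resolvent H (-I)) := by
        rw [resolvent, dif_pos hex]; exact hex.choose_spec
      obtain ⟨S, hS⟩ := not_not.1 hE
      have hne : ∀ t : ℝ, (t : ℂ) - -I ≠ 0 := fun t h => by
        have := congrArg Complex.im h
        simp at this
      have hgap := notMem_spectrum_of_isResolventAt hR hS (hne E)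
      have hcont : Continuous fun t : ℝ => ((t : ℂ) - -I)⁻¹ := by
        refine Continuous.inv₀ (by fun_prop) hne
      have hopen : IsOpen {t : ℝ | ((t : ℂ) - -I)⁻¹ ∉ spectrum ℂ (resolvent H (-I))} :=
        (spectrum.isClosed (resolvent H (-I))).isOpen_compl.preimage hcont
      obtain ⟨δ, hδ, hball⟩ := Metric.isOpen_iff.1 hopen E hgap
      let h : ℝ → ℝ := fun t => max 0 (min 1 (min (t + 1) ((E + δ - t) / (2 * δ))))
      have hhc : Continuous h := by
        have : Continuous fun t : ℝ => (E + δ - t) / (2 * δ) := by fun_prop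
        exact continuous_const.max (continuous_const.min ((continuous_id.add_const 1).min this))
      let hf : CompactlySupportedContinuousMap ℝ ℂ :=
        { toFun := fun t => (h t : ℂ)
          continuous_toFun := continuous_ofReal.comp hhc
          hasCompactSupport' := by
            refine HasCompactSupport.intro (isCompact_Icc (a := (-1 : ℝ)) (b := E + δ)) ?_
            intro t ht
            have : h t = 0 := by
              rw [Set.mem_Icc, not_and_or, not_le, not_le] at ht
              refine max_eq_left ?_
              rcases ht with ht | ht
              · exact (min_le_right _ _).trans ((min_le_left _ _).trans (by linarith))
              · refine (min_le_right _ _).trans ((min_le_right _ _).trans ?_)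
                exact div_nonpos_of_nonpos_of_nonneg (by linarith) (by linarith)
            rw [this, ofReal_zero] }
      have heq : fermiProjection H E = fc H hf := by
        refine cfc_congr fun z hz => ?_
        by_cases hz0 : z = 0
        · simp only [hz0, if_true]
        · simp only [hz0, if_false]
          obtain ⟨hp, hzt⟩ := mem_spectrum_resolvent hH.isSelfAdjoint hH.nonneg hR hn hz hz0
          set t := (z⁻¹ - I).re
          have hzz : ((t : ℂ) - -I)⁻¹ = z := by rw [sub_neg_eq_add, ← hzt, inv_inv]
          have hfar : δ ≤ |t - E| := by
            by_contra! hlt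
            refine hball (a := t) (by rwa [Metric.mem_ball, Real.dist_eq]) ?_
            rwa [hzz]
          change _ = (h t : ℂ)
          by_cases ht : t < E
          · rw [Set.indicator_of_mem (show t ∈ Set.Iio E from ht)]
            rw [abs_of_neg (by linarith)] at hfar
            have : h t = 1 := by
              have h3 : 1 ≤ (E + δ - t) / (2 * δ) := by
                rw [le_div_iff₀ (by linarith)]; linarith
              change max 0 (min 1 (min (t + 1) ((E + δ - t) / (2 * δ)))) = 1
              rw [min_eq_left (le_min (by linarith) h3), max_eq_right zero_le_one]
            rw [this, ofReal_one]
          · rw [Set.indicator_of_notMem (show t ∉ Set.Iio E from ht)]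
            rw [abs_of_nonneg (by linarith)] at hfar
            have : h t = 0 := by
              refine max_eq_left ((min_le_right _ _).trans ((min_le_right _ _).trans ?_))
              exact div_nonpos_of_nonpos_of_nonneg (by linarith) (by linarith)
            rw [this, ofReal_zero]
      rw [heq]
      exact hH.fc_mem hf
    · rw [fermiProjection, fc, cfc_apply_of_not_predicate _ hn]
      exact zero_mem _
  · have h0 : resolvent H (-I) = 0 := by rw [resolvent, dif_neg hex]
    have : fermiProjection H E = 0 := by
      rw [fermiProjection, fc, h0]
      refine Eq.trans (cfc_congr (g := 0) fun z hz => ?_) (cfc_zero ℂ (0 : ℋ →L[ℂ] ℋ))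
      have hz0 : z = 0 := by
        have := spectrum.norm_le_norm_mul_of_mem hz
        simpa using this
      simp [hz0]
    rw [this]
    exact zero_mem _

/-- The class `[p_E] ∈ K₀(C*_Roe(X))` of the Fermi projection of a Hamiltonian `H` which is
insulating at `E`. -/
def fermiClass {M : XModule X ℋ} {H : ℋ →ₗ.[ℂ] ℋ} (hH : IsCompatibleHamiltonian M H) {E : ℝ}
    (hE : IsInsulating H E) : KTheory.K0 M.roeAlgebra :=
  KTheory.K0.ofProjection (⟨fermiProjection H E, hH.fermiProjection_mem hE⟩ : M.roeAlgebra)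
    ⟨Subtype.ext (isStarProjection_fermiProjection H E).isIdempotentElem.eq,
      Subtype.ext (isStarProjection_fermiProjection H E).isSelfAdjoint.star_eq⟩

end hamiltonian

end Coarse

end

/-!
Suppose that `E` lies in a gap of the spectra of both `H` and `Htilde`. As both operators are
bounded from below, a single function `f ∈ C₀(ℝ)` agrees with the indicator function of `(-∞, E)` on
both spectra. Hence `p_E = f(H)` is congruent to the projection `q = f(Htilde) ∈ C*_Roe({Y})` modulo
`C*_Roe({X ∖ Y})`, so that `q` is a self-adjoint lift of the class of `p_E`. This lift being a
projection, `∂[p_E]` is the class of `exp(2πi q) = 1`.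
-/

namespace KTheory

theorem isStarProjection_mk {R 𝔅 : Type*} [CommSemiring R] [NonUnitalSemiring 𝔅] [StarRing 𝔅]
    [Module R 𝔅] {A : NonUnitalStarSubalgebra R 𝔅} {p : 𝔅} (hp : IsStarProjection p) (hpA : p ∈ A) :
    IsStarProjection (⟨p, hpA⟩ : A) :=
  ⟨Subtype.ext hp.isIdempotentElem.eq, Subtype.ext hp.isSelfAdjoint.star_eq⟩

namespace IsMayerVietoris

variable {𝔅 : Type*} [CStarAlgebra 𝔅] {A I J C : NonUnitalStarSubalgebra ℂ 𝔅}
  [IsClosed (A : Set 𝔅)] [IsClosed (C : Set 𝔅)]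

theorem expClass_eq_zero_of_isIdempotentElem_lift {ι : Type} [Fintype ι] [DecidableEq ι]
    (h : IsMayerVietoris A I J C) {p a : Matrix ι ι (Unitization ℂ A)} (hp : IsStarProjection p)
    (ha : IsIdempotentElem a) (hpa : IsLift A I J p a) : h.expClass p hp = 0 := by
  have hexp : IsExpLift A I J C p 1 := by
    refine ⟨a, hpa, fun i j => ?_⟩
    rw [matrix_exp_idempotent a ha]
    by_cases hij : i = j <;> simp [Matrix.one_apply, hij]
  rw [h.expClass_eq hp (one_mem _) hexp, UnitalK1.mk_one]

theorem boundary_ofProjection (h : IsMayerVietoris A I J C) (p : A) (hp : IsStarProjection p) :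
    h.boundary (K0.ofProjection p hp) = h.expClass _ (isStarProjection_inr hp) :=
  DFunLike.congr_fun (Algebra.GrothendieckAddGroup.lift.symm_apply_apply h.expV)
    (V.mk _ (isStarProjection_inr hp))

theorem boundary_ofProjection_eq_zero (h : IsMayerVietoris A I J C) {p : A} {q : 𝔅}
    (hp : IsStarProjection p) (hq : IsStarProjection q) (hqI : q ∈ I) (hpq : p - q ∈ J) :
    h.boundary (K0.ofProjection p hp) = 0 := by
  have hqA := isStarProjection_inr (isStarProjection_mk hq (h.left_le hqI))
  have hlift : IsLift A I J (Matrix.of fun _ _ : Unit => (p : Unitization ℂ A))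
      (Matrix.of fun _ _ : Unit => ((⟨q, h.left_le hqI⟩ : A) : Unitization ℂ A)) :=
    ⟨hqA.isSelfAdjoint, fun _ _ => ⟨rfl, hqI, by simpa using neg_mem hpq⟩⟩
  rw [h.boundary_ofProjection]
  exact h.expClass_eq_zero_of_isIdempotentElem_lift _ hqA.isIdempotentElem hlift

end IsMayerVietoris

end KTheory

namespace Coarse

open Complex
open scoped ComplexOrder ZeroAtInfty InnerProductSpace

variable {ℋ : Type*} [NormedAddCommGroup ℋ] [InnerProductSpace ℂ ℋ]

section Resolvent

variable {T : ℋ →ₗ.[ℂ] ℋ} {R S : ℋ →L[ℂ] ℋ} {a b : ℂ}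

theorem IsResolventAt.sub_eq_smul_mul (hR : IsResolventAt T a R) (hS : IsResolventAt T b S) :
    R - S = (a - b) • (R * S) := by
  ext v
  obtain ⟨hSv, hTS⟩ := hS.1 v
  have hRS : R (T ⟨S v, hSv⟩) - a • R (S v) = S v := by
    simpa only [map_sub, map_smul] using hR.2 ⟨S v, hSv⟩
  have hRv : R v = R (T ⟨S v, hSv⟩) - b • R (S v) := by
    rw [← map_smul, ← map_sub, hTS]
  change R v - S v = (a - b) • R (S v)
  rw [hRv, sub_eq_iff_eq_add.1 hRS]
  module

theorem IsResolventAt.commute (hR : IsResolventAt T a R) (hS : IsResolventAt T b S) :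
    Commute R S := by
  have hRS := hR.sub_eq_smul_mul hS
  rcases eq_or_ne a b with rfl | hab
  · rw [sub_self, zero_smul, sub_eq_zero] at hRS
    exact hRS ▸ Commute.refl R
  · have hSR : R - S = (a - b) • (S * R) := by
      rw [← neg_sub S R, hS.sub_eq_smul_mul hR, ← neg_smul, neg_sub]
    exact smul_right_injective _ (sub_ne_zero.2 hab) (hRS.symm.trans hSR)

theorem IsResolventAt.exists_of_isUnit (hR : IsResolventAt T a R)
    (hu : IsUnit (1 - (b - a) • R)) : ∃ S, IsResolventAt T b S := by
  obtain ⟨U, hU⟩ := hu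
  have hUapply : ∀ v, (U : ℋ →L[ℂ] ℋ) v = v - (b - a) • R v := fun v => by rw [hU]; rfl
  have hUinv : ∀ v, (U : ℋ →L[ℂ] ℋ) ((↑U⁻¹ : ℋ →L[ℂ] ℋ) v) = v :=
    DFunLike.congr_fun U.mul_inv
  have hinvU : ∀ v, (↑U⁻¹ : ℋ →L[ℂ] ℋ) ((U : ℋ →L[ℂ] ℋ) v) = v :=
    DFunLike.congr_fun U.inv_mul
  refine ⟨R * ↑U⁻¹, fun v => ?_, fun x => ?_⟩
  · obtain ⟨hRv, hTR⟩ := hR.1 ((↑U⁻¹ : ℋ →L[ℂ] ℋ) v)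
    refine ⟨hRv, ?_⟩
    calc T ⟨R ((↑U⁻¹ : ℋ →L[ℂ] ℋ) v), hRv⟩ - b • R ((↑U⁻¹ : ℋ →L[ℂ] ℋ) v)
        = (U : ℋ →L[ℂ] ℋ) ((↑U⁻¹ : ℋ →L[ℂ] ℋ) v) := by
          rw [hUapply, sub_eq_iff_eq_add.1 hTR]
          module
      _ = v := hUinv v
  · have hx : T x - b • (x : ℋ) = (U : ℋ →L[ℂ] ℋ) (T x - a • (x : ℋ)) := by
      rw [hUapply, hR.2 x]
      module
    change R ((↑U⁻¹ : ℋ →L[ℂ] ℋ) (T x - b • (x : ℋ))) = x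
    rw [hx, hinvU, hR.2 x]

theorem isResolventAt_resolvent_of_mem_spectrum {w : ℂ} (hw : w ∈ spectrum ℂ (resolvent T a))
    (hw0 : w ≠ 0) : IsResolventAt T a (resolvent T a) := by
  have hex : ∃ R, IsResolventAt T a R := by
    by_contra hex
    rw [resolvent, dif_neg hex] at hw
    refine spectrum.mem_iff.1 hw ?_
    rw [sub_zero]
    exact (IsUnit.mk0 w hw0).map (algebraMap ℂ (ℋ →L[ℂ] ℋ))
  rw [resolvent, dif_pos hex]
  exact hex.choose_spec

/-- The operator `T` is bounded from below by `c`, that is, `⟪x, T x⟫ ≥ c ‖x‖²` for all `x` in its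
domain. Only the real part is compared, since `⟪x, T x⟫` is real for self-adjoint `T`. -/
def IsBoundedBelowBy (T : ℋ →ₗ.[ℂ] ℋ) (c : ℝ) : Prop :=
  ∀ x : T.domain, c * ‖(x : ℋ)‖ ^ 2 ≤ (inner ℂ (x : ℋ) (T x)).re

variable [CompleteSpace ℋ]

theorem isClosed_spec (T : ℋ →ₗ.[ℂ] ℋ) : IsClosed (spec T) := by
  rw [← isOpen_compl_iff, isOpen_iff_mem_nhds]
  intro a ha
  obtain ⟨R, hR⟩ := not_not.1 ha
  have hopen : IsOpen {b : ℂ | IsUnit (1 - (b - a) • R)} :=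
    Units.isOpen.preimage (by fun_prop : Continuous fun b : ℂ => 1 - (b - a) • R)
  filter_upwards [hopen.mem_nhds (show IsUnit (1 - (a - a) • R) by simp)] with b hb
  exact not_not.2 (hR.exists_of_isUnit hb)

theorem IsResolventAt.adjoint (hT : IsSelfAdjoint T) (hR : IsResolventAt T a R) :
    IsResolventAt T (star a) (star R) := by
  have hsymm : T.IsFormalAdjoint T := by
    simpa only [LinearPMap.isSelfAdjoint_def.1 hT] using
      LinearPMap.adjoint_isFormalAdjoint hT.dense_domain
  have hweak : ∀ v (x : T.domain), ⟪v + star a • star R v, (x : ℋ)⟫_ℂ = ⟪star R v, T x⟫_ℂ := by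
    intro v x
    have hv : ⟪v, (x : ℋ)⟫_ℂ = ⟪star R v, T x - a • (x : ℋ)⟫_ℂ := by
      rw [ContinuousLinearMap.star_eq_adjoint, ContinuousLinearMap.adjoint_inner_left, hR.2 x]
    rw [inner_add_left, hv, inner_sub_right, inner_smul_right, inner_smul_left, Complex.star_def,
      conj_conj, sub_add_cancel]
  constructor
  · intro v
    have hmem : star R v ∈ T.domain := by
      have := LinearPMap.mem_adjoint_domain_of_exists (star R v) ⟨_, hweak v⟩
      rwa [LinearPMap.isSelfAdjoint_def.1 hT] at this
    have hTv : T ⟨star R v, hmem⟩ = v + star a • star R v :=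
      hT.dense_domain.eq_of_inner_left ℂ fun x hx =>
        (hsymm ⟨star R v, hmem⟩ ⟨x, hx⟩).trans (hweak v ⟨x, hx⟩).symm
    exact ⟨hmem, by rw [hTv, add_sub_cancel_right]⟩
  · intro x
    refine ext_inner_right ℂ fun w => ?_
    obtain ⟨hRw, hTR⟩ := hR.1 w
    rw [ContinuousLinearMap.star_eq_adjoint, ContinuousLinearMap.adjoint_inner_left]
    calc ⟪T x - star a • (x : ℋ), R w⟫_ℂ = ⟪(x : ℋ), T ⟨R w, hRw⟩ - a • R w⟫_ℂ := by
          rw [inner_sub_left, inner_sub_right, inner_smul_left, inner_smul_right,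
            hsymm x ⟨R w, hRw⟩, Complex.star_def, conj_conj]
      _ = ⟪(x : ℋ), w⟫_ℂ := by rw [hTR]

theorem IsResolventAt.isStarNormal (hT : IsSelfAdjoint T) (hR : IsResolventAt T a R) :
    IsStarNormal R :=
  ⟨(hR.adjoint hT).commute hR⟩

theorem IsBoundedBelowBy.le_inner {c : ℝ} (hc : IsBoundedBelowBy T c) (hT : IsSelfAdjoint T)
    (x : T.domain) : (c : ℂ) * ⟪(x : ℋ), x⟫_ℂ ≤ ⟪T x, (x : ℋ)⟫_ℂ := by
  have hreal : (starRingEnd ℂ) ⟪(x : ℋ), T x⟫_ℂ = ⟪(x : ℋ), T x⟫_ℂ := by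
    rw [inner_conj_symm, inner_comm_of_isSelfAdjoint hT x]
  rw [inner_comm_of_isSelfAdjoint hT x, ← conj_eq_iff_re.1 hreal, inner_self_eq_norm_sq_to_K]
  have hle := real_le_real.2 (hc x)
  push_cast at hle
  exact hle

theorem IsResolventAt.adjoint_add_nonneg {c : ℝ} (hT : IsSelfAdjoint T)
    (hc : IsBoundedBelowBy T c) (hR : IsResolventAt T a R) :
    0 ≤ star R + (a - c) • (star R * R) := by
  -- The operator is `R* (T - c) R`.
  rw [ContinuousLinearMap.nonneg_iff_isPositive]
  refine (ContinuousLinearMap.isPositive_iff_complex _).2 fun v => ?_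
  obtain ⟨hRv, hTR⟩ := hR.1 v
  have hform : ⟪(star R + (a - c) • (star R * R)) v, v⟫_ℂ =
      ⟪T ⟨R v, hRv⟩, R v⟫_ℂ - c * ⟪R v, R v⟫_ℂ := by
    rw [sub_eq_iff_eq_add.1 hTR]
    simp only [add_apply, smul_apply, mul_apply_eq_comp, ContinuousLinearMap.star_eq_adjoint,
      inner_add_left, inner_smul_left, ContinuousLinearMap.adjoint_inner_left, map_sub, conj_ofReal]
    ring
  have hle : 0 ≤ ⟪T ⟨R v, hRv⟩, R v⟫_ℂ - c * ⟪R v, R v⟫_ℂ :=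
    sub_nonneg.2 (hc.le_inner hT ⟨R v, hRv⟩)
  rw [hform]
  exact ⟨Complex.ext (ofReal_re _) ((ofReal_im _).trans (Complex.le_def.1 hle).2),
    (Complex.le_def.1 hle).1⟩

theorem IsResolventAt.le_of_mem_spectrum {c : ℝ} {w : ℂ} (hT : IsSelfAdjoint T)
    (hc : IsBoundedBelowBy T c) (hR : IsResolventAt T a R) (hw : w ∈ spectrum ℂ R) (hw0 : w ≠ 0) :
    (c : ℂ) ≤ w⁻¹ + a := by
  have := hR.isStarNormal hT
  have hcfc : cfc (fun z : ℂ => star z + (a - c) * (star z * z)) R =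
      star R + (a - c) • (star R * R) := by
    rw [cfc_add R (fun z : ℂ => star z) (fun z => (a - c) * (star z * z)),
      cfc_const_mul (a - c : ℂ) (fun z : ℂ => star z * z) R,
      cfc_mul (fun z : ℂ => star z) (fun z => z) R, cfc_star_id R, cfc_id' ℂ R]
  have hnonneg : 0 ≤ star w + (a - c) * (star w * w) :=
    (cfc_nonneg_iff (fun z : ℂ => star z + (a - c) * (star z * z)) R).1
      (hcfc ▸ hR.adjoint_add_nonneg hT hc) w hw
  have hstar : star w ≠ 0 := star_ne_zero.2 hw0
  have hfactor : w⁻¹ + a - c =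
      ((normSq w)⁻¹ : ℝ) * (star w + (a - c) * (star w * w)) := by
    rw [ofReal_inv, normSq_eq_conj_mul_self, ← Complex.star_def]
    field_simp
    ring
  rw [← sub_nonneg, hfactor]
  exact mul_nonneg (zero_le_real.2 (inv_nonneg.2 (normSq_nonneg w))) hnonneg

end Resolvent

section FunctionalCalculus

variable [CompleteSpace ℋ] {T : ℋ →ₗ.[ℂ] ℋ} {c : ℝ}

theorem fc_congr (hT : IsSelfAdjoint T) (hc : IsBoundedBelowBy T c) {f g : ℝ → ℂ}
    (hfg : Set.EqOn f g (Set.Ici c ∩ (fun t : ℝ => (t : ℂ)) ⁻¹' spec T)) : fc T f = fc T g := by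
  refine cfc_congr fun w hw => ?_
  by_cases hw0 : w = 0
  · simp only [hw0, if_true]
  have hR := isResolventAt_resolvent_of_mem_spectrum hw hw0
  have hle : (c : ℂ) ≤ w⁻¹ - I := hR.le_of_mem_spectrum hT hc hw hw0
  have hreal : ((w⁻¹ - I).re : ℂ) = w⁻¹ - I :=
    Complex.ext (ofReal_re _) ((ofReal_im _).trans (Complex.le_def.1 hle).2)
  simp only [hw0, if_false]
  refine hfg ⟨(Complex.le_def.1 hle).1, fun ⟨S, hS⟩ => ?_⟩
  have hb : (w⁻¹ - I) - -I = w⁻¹ := by ring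
  replace hS : IsResolventAt T (w⁻¹ - I) S := hreal ▸ hS
  refine notMem_spectrum_of_isResolventAt hR hS ?_ ?_
  · rw [hb]
    exact inv_ne_zero hw0
  · rwa [hb, inv_inv]

theorem exists_zeroAtInfty_eqOn_indicator_Iio {S : Set ℝ} (hS : IsClosed S) (hb : BddBelow S)
    {E : ℝ} (hE : E ∉ S) : ∃ f : C₀(ℝ, ℂ), Set.EqOn f ((Set.Iio E).indicator fun _ => 1) S := by
  obtain ⟨c, hc⟩ := hb
  have hcompact : IsCompact (S ∩ Set.Iic E) :=
    isCompact_Icc.of_isClosed_subset (hS.inter isClosed_Iic) fun t ht => ⟨hc ht.1, ht.2⟩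
  have hdisj : Disjoint (S ∩ Set.Iic E) (S ∩ Set.Ici E) :=
    Set.disjoint_left.2 fun t ht ht' => hE (le_antisymm (Set.mem_Iic.1 ht.2) ht'.2 ▸ ht.1)
  obtain ⟨f, hf1, hf0, hf, -⟩ :=
    exists_continuous_one_zero_of_isCompact hcompact (hS.inter isClosed_Ici) hdisj
  refine ⟨⟨⟨fun t => (f t : ℂ), by fun_prop⟩, (hf.comp_left ofReal_zero).is_zero_at_infty⟩,
    fun t ht => ?_⟩
  change (f t : ℂ) = _
  by_cases htE : t < E
  · rw [hf1 ⟨ht, htE.le⟩, Set.indicator_of_mem (Set.mem_Iio.2 htE), Pi.one_apply, ofReal_one]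
  · rw [hf0 ⟨ht, not_lt.1 htE⟩, Set.indicator_of_notMem (mt Set.mem_Iio.1 htE), Pi.zero_apply,
      ofReal_zero]

variable {𝒦 : Type*} [NormedAddCommGroup 𝒦] [InnerProductSpace ℂ 𝒦] [CompleteSpace 𝒦]

theorem exists_zeroAtInfty_fc_eq_fermiProjection (hT : IsSelfAdjoint T)
    (hc : IsBoundedBelowBy T c) {T' : 𝒦 →ₗ.[ℂ] 𝒦} (hT' : IsSelfAdjoint T') {c' : ℝ}
    (hc' : IsBoundedBelowBy T' c') {E : ℝ} (hE : IsInsulating T E) (hE' : IsInsulating T' E) :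
    ∃ f : C₀(ℝ, ℂ), fc T f = fermiProjection T E ∧ fc T' f = fermiProjection T' E := by
  have hclosed : IsClosed
      (Set.Ici (min c c') ∩ (fun t : ℝ => (t : ℂ)) ⁻¹' (spec T ∪ spec T')) :=
    isClosed_Ici.inter (((isClosed_spec T).union (isClosed_spec T')).preimage continuous_ofReal)
  obtain ⟨f, hf⟩ := exists_zeroAtInfty_eqOn_indicator_Iio hclosed
    (bddBelow_Ici.mono Set.inter_subset_left) (E := E) fun h => h.2.elim hE hE'
  refine ⟨f, fc_congr hT hc fun t ht => hf ⟨?_, Or.inl ht.2⟩,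
    fc_congr hT' hc' fun t ht => hf ⟨?_, Or.inr ht.2⟩⟩
  · exact (min_le_left c c').trans ht.1
  · exact (min_le_right c c').trans ht.1

theorem isStarProjection_conj_adjoint (j : 𝒦 →ₗᵢ[ℂ] ℋ) {q : 𝒦 →L[ℂ] 𝒦}
    (hq : IsStarProjection q) :
    IsStarProjection (j.toContinuousLinearMap ∘L q ∘L j.toContinuousLinearMap.adjoint) := by
  have hj : j.toContinuousLinearMap.adjoint ∘L j.toContinuousLinearMap = 1 :=
    (ContinuousLinearMap.norm_map_iff_adjoint_comp_self j.toContinuousLinearMap).1 j.norm_map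
  refine ⟨?_, hq.isSelfAdjoint.conj_adjoint _⟩
  ext v
  have hjv : ∀ v, j.toContinuousLinearMap.adjoint (j v) = v := DFunLike.congr_fun hj
  have hqv : ∀ v, q (q v) = q v := DFunLike.congr_fun hq.isIdempotentElem.eq
  simp [hjv, hqv]

end FunctionalCalculus

end Coarse

open scoped ZeroAtInfty in
theorem mainTheorem1_general {ℋ : Type*} [NormedAddCommGroup ℋ] [InnerProductSpace ℂ ℋ]
    [CompleteSpace ℋ] {A I J C : NonUnitalStarSubalgebra ℂ (ℋ →L[ℂ] ℋ)}
    [IsClosed (A : Set (ℋ →L[ℂ] ℋ))] [IsClosed (C : Set (ℋ →L[ℂ] ℋ))]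
    (h : KTheory.IsMayerVietoris A I J C)
    {H : ℋ →ₗ.[ℂ] ℋ} (hH : IsSelfAdjoint H) {c : ℝ} (hc : Coarse.IsBoundedBelowBy H c)
    {𝒦 : Type*} [NormedAddCommGroup 𝒦] [InnerProductSpace ℂ 𝒦] [CompleteSpace 𝒦]
    (j : 𝒦 →ₗᵢ[ℂ] ℋ) {Htilde : 𝒦 →ₗ.[ℂ] 𝒦} (hHtilde : IsSelfAdjoint Htilde)
    {c' : ℝ} (hc' : Coarse.IsBoundedBelowBy Htilde c')
    (hI : ∀ f : C₀(ℝ, ℂ),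
      j.toContinuousLinearMap ∘L Coarse.fc Htilde f ∘L j.toContinuousLinearMap.adjoint ∈ I)
    (hJ : ∀ f : C₀(ℝ, ℂ), Coarse.fc H f -
      j.toContinuousLinearMap ∘L Coarse.fc Htilde f ∘L j.toContinuousLinearMap.adjoint ∈ J)
    {E : ℝ} (hE : Coarse.IsInsulating H E) (hp : Coarse.fermiProjection H E ∈ A)
    (hne : h.boundary (KTheory.K0.ofProjection ⟨Coarse.fermiProjection H E, hp⟩
      (KTheory.isStarProjection_mk (Coarse.isStarProjection_fermiProjection H E) hp)) ≠ 0) :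
    (E : ℂ) ∈ Coarse.spec Htilde := by
  by_contra hE'
  obtain ⟨f, hfH, hfHtilde⟩ :=
    Coarse.exists_zeroAtInfty_fc_eq_fermiProjection hH hc hHtilde hc' hE hE'
  have hq := Coarse.isStarProjection_conj_adjoint j
    (Coarse.isStarProjection_fermiProjection Htilde E)
  have hqI := hI f
  have hpq := hJ f
  rw [hfHtilde] at hqI hpq
  rw [hfH] at hpq
  exact hne (h.boundary_ofProjection_eq_zero _ hq hqI hpq)

theorem mainTheorem1 {X : Type*} [MetricSpace X]
    {ℋ : Type*} [NormedAddCommGroup ℋ] [InnerProductSpace ℂ ℋ] [CompleteSpace ℋ]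
    (M : Coarse.XModule X ℋ) (hM : M.IsAmple)
    (H : ℋ →ₗ.[ℂ] ℋ) (hH : Coarse.IsCompatibleHamiltonian M H)
    (Y : Set X)
    {𝒦 : Type*} [NormedAddCommGroup 𝒦] [InnerProductSpace ℂ 𝒦] [CompleteSpace 𝒦]
    (j : 𝒦 →ₗᵢ[ℂ] ℋ) (Htilde : 𝒦 →ₗ.[ℂ] 𝒦)
    (hHtilde : Coarse.IsAdaptedHamiltonian M H Y j Htilde)
    (E : ℝ) (hE : Coarse.IsInsulating H E)
    (hne : M.coarseBoundaryMap Y (Coarse.fermiClass hH hE) ≠ 0) :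
    (E : ℂ) ∈ Coarse.spec Htilde := by
  obtain ⟨c, hc⟩ := hHtilde.bddBelow
  exact mainTheorem1_general (M.isMayerVietoris Y) hH.isSelfAdjoint (c := 0)
    (fun x => by simpa only [zero_mul] using hH.nonneg x) j hHtilde.isSelfAdjoint hc
    hHtilde.fc_mem hHtilde.sub_mem hE (hH.fermiProjection_mem hE) hne
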